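/- Let $m,k,n\ge 1$ be integers, let $G=(V,E)$ be a connected undirected graph on $V=\{1,\dots,m\}$ with graph distance $d_{vw}$, and let $P_1,\dots,P_k$ be probability distributions on $\mathbb{R}$ with means $\mu_a$ that are $\sigma$-subgaussian, i.e. $\mathbb{E}_{x\sim P_a}[e^{\lambda(x-\mu_a)}]\le e^{\lambda^2\sigma^2/2}$ for all $\lambda\in\mathbb{R}$ and all $a$, where $\sigma\ge 0$. Put $\Delta_a=\max_b\mu_b-\mu_a$. In each round $t=1,\dots,n$ every agent $w\in V$ plays an action $A_t^w\in\{1,\dots,k\}$ and receives a reward $X_t^w$; given all previous actions and rewards and the actions of round $t$, the rewards of round $t$ are independent and $X_t^w$ has law $P_{A_t^w}$. The group regret is $$R_G(n)=\sum_{a=1}^k\Delta_a\,\mathbb{E}\Big[\sum_{w=1}^m T_{aw}(n)\Big],\qquad T_{aw}(n)=\sum_{t=1}^n \mathbf 1\{A_t^w=a\}.$$ The upper confidence bound algorithm with confidence parameter $\delta$ selects, from the action-reward pairs it has been updated with so far, an action $a$ maximizing $\hat\mu_a+\sqrt{2\sigma^2\ln(1/\delta)/N_a}$, where $N_a$ is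 the number of pairs with action $a$ and $\hat\mu_a$ is the mean of their rewards; the index is $+\infty$ if $N_a=0$, and ties are broken by an arbitrary measurable deterministic rule. QuACK with leader $v\in V$ and single-agent bandit algorithm $\pi$ chooses the actions as follows. The leader keeps a first-in-first-out queue $Q_a$ of rewards, initially empty, for every action $a$. In round $t$ the leader receives $(A_{t-d_{vw}}^w,X_{t-d_{vw}}^w)$ from each $w\ne v$ with $t>d_{vw}$ (in increasing order of $w$) and appends each reward to the queue of its action. Then, as long as the queue of the action $a$ selected by $\pi$ is non-empty, the leader removes the first reward $x$ from $Q_a$, updates $\pi$ with $(a,x)$ and lets $\pi$ select again. When the selected action $a$ has an empty queue, the leader plays $A_t^v=a$ and updates $\pi$ with $(a,X_t^v)$. A follower $w\neq v$ plays $A_t^w=A_{t-d_{vw}}^v$ if $t>d_{vw}$; if $t\le d_{vw}$ it plays an action drawn uniformly at random, independently of the past and of the other followers. Then, for every leader $v\in V$, QuACK with leader $v$, where $\pi$ is the upper confidence bound algorithm with $\delta=1/(mn)^2$, satisfies $$R_G(n)\le\sum_{a:\,\Delta_a>0}\frac{16\sigma^2\ln(mn)}{\Delta_a}+\Big(3+3\sum_{w=1}^m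 d_{vw}\Big)\sum_{a:\,\Delta_a>0}\Delta_a .$$ -/

import Mathlib

open MeasureTheory ProbabilityTheory
open scoped NNReal ENNReal

noncomputable section

namespace Quack

/-! ### Single-agent bandit algorithms and UCB -/

/-- A (deterministic) single-agent bandit algorithm for `k` actions: it selects an action from the
list of the action-reward pairs it has been updated with so far, oldest first. -/
abbrev Policy (k : ℕ) : Type := List (Fin k × ℝ) → Fin k

/-- The number of times action `a` occurs in the history `h`. -/
def histCount {k : ℕ} (h : List (Fin k × ℝ)) (a : Fin k) : ℕ :=
  (h.filter fun p => p.1 = a).length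

/-- The empirical mean of the rewards of action `a` in the history `h`. -/
def histMean {k : ℕ} (h : List (Fin k × ℝ)) (a : Fin k) : ℝ :=
  ((h.filter fun p => p.1 = a).map Prod.snd).sum / histCount h a

/-- The upper confidence bound of action `a` after the history `h`, for `σ`-subgaussian rewards and
confidence parameter `δ`; it is `∞` for an action that has not been tried. -/
def ucbIndex {k : ℕ} (σ δ : ℝ) (h : List (Fin k × ℝ)) (a : Fin k) : EReal :=
  if histCount h a = 0 then ⊤
  else ((histMean h a + √(2 * σ ^ 2 * Real.log (1 / δ) / histCount h a) : ℝ) : EReal)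

/-- `π` is the upper confidence bound algorithm with parameters `σ`, `δ`: it always selects an
action of maximal index, ties being broken by an arbitrary measurable rule. -/
structure IsUCB {k : ℕ} (σ δ : ℝ) (π : Policy k) : Prop where
  measurable : ∀ s : ℕ, Measurable fun h : Fin s → Fin k × ℝ => π (List.ofFn h)
  isMax : ∀ (h : List (Fin k × ℝ)) (a : Fin k), ucbIndex σ δ h a ≤ ucbIndex σ δ h (π h)

/-! ### The leader in QuACK -/

/-- The memory of the leader: the data with which the bandit algorithm has been updated, and a
first-in first-out queue of rewards for every action. -/
structure LeaderState (k : ℕ) where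
  hist : List (Fin k × ℝ)
  queue : Fin k → List ℝ

/-- The while loop of the leader: as long as the queue of the action selected by `π` is not empty,
remove its first reward, update `π` with it and select again. -/
def drain {k : ℕ} (π : Policy k) (S : LeaderState k) : LeaderState k :=
  match _hq : S.queue (π S.hist) with
  | [] => S
  | x :: q =>
    drain π ⟨S.hist ++ [(π S.hist, x)], Function.update S.queue (π S.hist) q⟩
termination_by ∑ a, (S.queue a).length
decreasing_by
  refine Finset.sum_lt_sum (fun a _ => ?_) ⟨π S.hist, Finset.mem_univ _, by simp [_hq]⟩
  by_cases h : a = π S.hist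
  · subst h; simp [_hq]
  · simp [Function.update_of_ne h]

/-- The messages that reach the leader `v` in round `t`: from every other agent `w`, the action and
reward of `w` in round `t - d_{vw}`, if `t - d_{vw} ≥ 1`. Here `act s w` and `rew s w` are the action
and the reward of agent `w` in round `s`. -/
def messages {m k : ℕ} (G : SimpleGraph (Fin m)) (v : Fin m)
    (act : ℕ → Fin m → Fin k) (rew : ℕ → Fin m → ℝ) (t : ℕ) : List (Fin k × ℝ) :=
  ((List.finRange m).filter fun w => w ≠ v ∧ G.dist v w < t).map
    fun w => (act (t - G.dist v w) w, rew (t - G.dist v w) w)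

/-- Append the rewards contained in a list of messages to the queues of their actions. -/
def enqueue {k : ℕ} (M : List (Fin k × ℝ)) (S : LeaderState k) : LeaderState k where
  hist := S.hist
  queue a := S.queue a ++ (M.filter fun p => p.1 = a).map Prod.snd

/-- The memory of the leader `v` at the end of round `t`. In each round the leader receives the
messages, runs the while loop, plays the action then selected by `π`, and updates `π` with that
action and the reward it brought. -/
def leaderState {m k : ℕ} (G : SimpleGraph (Fin m)) (v : Fin m) (π : Policy k)
    (act : ℕ → Fin m → Fin k) (rew : ℕ → Fin m → ℝ) : ℕ → LeaderState k
  | 0 => ⟨[], fun _ => []⟩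
  | t + 1 =>
    let S := drain π (enqueue (messages G v act rew (t + 1)) (leaderState G v π act rew t))
    ⟨S.hist ++ [(π S.hist, rew (t + 1) v)], S.queue⟩

/-- The action that the leader `v` plays in round `t ≥ 1`. It depends on `act s w` and `rew s w` for
`1 ≤ s < t` only. -/
def leaderAction {m k : ℕ} (G : SimpleGraph (Fin m)) (v : Fin m) (π : Policy k)
    (act : ℕ → Fin m → Fin k) (rew : ℕ → Fin m → ℝ) (t : ℕ) : Fin k :=
  π (drain π (enqueue (messages G v act rew t) (leaderState G v π act rew (t - 1)))).hist

/-! ### The interaction of the network with the environment -/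

/-- The information generated by the actions `A s w` and rewards `X s w` of all agents `w` in the
rounds `1 ≤ s < t`. -/
@[reducible]
def past {m k : ℕ} {Ω : Type*} (A : ℕ → Fin m → Ω → Fin k) (X : ℕ → Fin m → Ω → ℝ) (t : ℕ) :
    MeasurableSpace Ω :=
  ⨆ s ∈ Finset.Ico 1 t, ⨆ w : Fin m,
    (MeasurableSpace.comap (A s w) inferInstance ⊔ MeasurableSpace.comap (X s w) inferInstance)

/-- The stochastic bandit environment with reward distributions `P a`, over `n` rounds: given the
past and the actions of the current round, the rewards `X t w` of that round are independent and
`X t w` has distribution `P (A t w)`. -/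
structure IsBanditInteraction {m k : ℕ} {Ω : Type*} [MeasurableSpace Ω] (ν : Measure Ω)
    (P : Fin k → Measure ℝ) (n : ℕ)
    (A : ℕ → Fin m → Ω → Fin k) (X : ℕ → Fin m → Ω → ℝ) : Prop where
  measurable_action : ∀ t ∈ Finset.Icc 1 n, ∀ w, Measurable (A t w)
  measurable_reward : ∀ t ∈ Finset.Icc 1 n, ∀ w, Measurable (X t w)
  reward_law : ∀ t ∈ Finset.Icc 1 n, ∀ E : Set Ω, MeasurableSet[past A X t] E →
    ∀ (α : Fin m → Fin k) (B : Fin m → Set ℝ), (∀ w, MeasurableSet (B w)) →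
      ν (E ∩ {ω | ∀ w, A t w ω = α w} ∩ {ω | ∀ w, X t w ω ∈ B w}) =
        ν (E ∩ {ω | ∀ w, A t w ω = α w}) * ∏ w, P (α w) (B w)

/-- During `n` rounds the agents choose their actions by QuACK with leader `v` and single-agent
algorithm `π`. A follower `w` repeats the leader's action of `d_{vw}` rounds before; while `t ≤ d_{vw}`
it plays uniformly at random, independently of the past and of the other followers. -/
structure IsQuack {m k : ℕ} {Ω : Type*} [MeasurableSpace Ω] (ν : Measure Ω)
    (G : SimpleGraph (Fin m)) (v : Fin m) (π : Policy k) (n : ℕ)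
    (A : ℕ → Fin m → Ω → Fin k) (X : ℕ → Fin m → Ω → ℝ) : Prop where
  leader : ∀ t ∈ Finset.Icc 1 n, ∀ ω,
    A t v ω = leaderAction G v π (fun s w => A s w ω) (fun s w => X s w ω) t
  follower : ∀ t ∈ Finset.Icc 1 n, ∀ w, w ≠ v → G.dist v w < t →
    ∀ ω, A t w ω = A (t - G.dist v w) v ω
  uniform : ∀ t ∈ Finset.Icc 1 n, ∀ E : Set Ω, MeasurableSet[past A X t] E →
    ∀ α : Fin m → Fin k,
      ν (E ∩ {ω | ∀ w, w ≠ v → t ≤ G.dist v w → A t w ω = α w}) =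
        ν E * ((k : ℝ≥0∞)⁻¹) ^ (Finset.univ.filter fun w => w ≠ v ∧ t ≤ G.dist v w).card

/-! ### Regret -/

/-- The mean `μ_a` of the reward distribution of action `a`. -/
def rewardMean {k : ℕ} (P : Fin k → Measure ℝ) (a : Fin k) : ℝ := ∫ x, x ∂(P a)

/-- The sub-optimality gap `Δ_a = max_b μ_b - μ_a`. -/
def gap {k : ℕ} (P : Fin k → Measure ℝ) (a : Fin k) : ℝ :=
  (⨆ b, rewardMean P b) - rewardMean P a

/-- `T_{aw}(n)`: the number of plays of action `a` by agent `w` in the rounds `1, …, n`. -/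
def plays {m k : ℕ} {Ω : Type*} (A : ℕ → Fin m → Ω → Fin k) (a : Fin k) (w : Fin m) (n : ℕ)
    (ω : Ω) : ℕ :=
  ((Finset.Icc 1 n).filter fun t => A t w ω = a).card

/-- The group regret `R_G(n)`. -/
def groupRegret {m k : ℕ} {Ω : Type*} [MeasurableSpace Ω] (ν : Measure Ω)
    (P : Fin k → Measure ℝ) (A : ℕ → Fin m → Ω → Fin k) (n : ℕ) : ℝ :=
  ∑ a, gap P a * ∫ ω, (∑ w, (plays A a w n ω : ℝ)) ∂ν

end Quack

end

namespace Quack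

/-! ### Histories -/

section Histories

variable {k : ℕ}

/-! It suffices to bound, for each suboptimal `a`, the expected number of plays of `a` in the whole
network by `16σ² ln(mn)/Δ_a² + 3 + 2∑ d_vw`.

Pathwise, let `s` be the last round in which the leader plays `a`. The queue of `a` is then empty,
so every play of `a` reported by round `s` has been fed to `π`. Since a follower at distance `d`
copies the leader with delay `d`, its other plays of `a` lie in the rounds `(s - d, s + d]`. Hence
all but `2∑ d_vw` plays of `a` are updates of `π` (`sum_card_plays_le`).

Delays and queues reorder the rewards given to `π`, so independence along its updates is not
immediate. Give each action a stack of independent rewards, consumed by the plays in order of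
arrival at the leader. First-in-first-out queues make `π` read each stack in order, so the leader's
memory follows a single-agent run on the stacks (`leaderState_onStack`). To compare laws, fix the
array `α` of all actions. On that event the rewards have law at most `k^(-F)` times a product
measure, where `F` counts the random plays of followers (`map_restrict_le`). Distinct plays use
distinct slots, so this product measure is an image of the law of the stacks. For given stacks at
most `k^F` arrays obey the protocol (`card_consistent_le`), so summing over `α` cancels the factor
(`measure_lt_histCount_le`).

On the stacks, the usual UCB union bound shows that more than `u > 16σ² ln(mn)/Δ_a²` plays of `a` in
`mn` rounds have probability at most `2/(mn)` (`measureReal_lt_histCount_stackRun_le`). That event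
contributes at most `2` to the expectation, and rounding `u` to an integer at most `1`. -/

@[simp] lemma histCount_nil (a : Fin k) : histCount ([] : List (Fin k × ℝ)) a = 0 := rfl

lemma histCount_append (h h' : List (Fin k × ℝ)) (a : Fin k) :
    histCount (h ++ h') a = histCount h a + histCount h' a := by
  simp [histCount]

lemma histCount_singleton (p : Fin k × ℝ) (a : Fin k) :
    histCount [p] a = if p.1 = a then 1 else 0 := by
  by_cases h : p.1 = a <;> simp [histCount, h]

lemma histCount_mono {h h' : List (Fin k × ℝ)} (hh : h <+: h') (a : Fin k) :
    histCount h a ≤ histCount h' a := by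
  obtain ⟨l, rfl⟩ := hh
  simp [histCount_append]

lemma histCount_le_length (h : List (Fin k × ℝ)) (a : Fin k) : histCount h a ≤ h.length :=
  List.length_filter_le _ _

lemma sum_length_filter_eq {β : Type*} (f : β → Fin k) (l : List β) :
    ∑ a, (l.filter fun p => f p = a).length = l.length := by
  induction l with
  | nil => simp
  | cons x l ih =>
    have : ∀ a, ((x :: l).filter fun p => f p = a).length =
        (if f x = a then 1 else 0) + (l.filter fun p => f p = a).length := by
      intro a
      by_cases h : f x = a <;> simp [h, add_comm]
    simp [this, Finset.sum_add_distrib, ih, add_comm]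

lemma sum_histCount (h : List (Fin k × ℝ)) : ∑ a, histCount h a = h.length :=
  sum_length_filter_eq Prod.fst h

end Histories

/-! ### The single-agent algorithm on stacks of rewards -/

section StackRun

variable {k : ℕ} (π : Policy k) (z : Fin k × ℕ → ℝ)

/-- The history of the bandit algorithm `π` after `j` updates, if the `i`-th play of action `a`
(counted from `0`) brings the reward `z (a, i)`. -/
def stackRun : ℕ → List (Fin k × ℝ)
  | 0 => []
  | j + 1 => stackRun j ++
      [(π (stackRun j), z (π (stackRun j), histCount (stackRun j) (π (stackRun j))))]

@[simp] lemma stackRun_zero : stackRun π z 0 = [] := rfl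

lemma stackRun_succ (j : ℕ) : stackRun π z (j + 1) = stackRun π z j ++
    [(π (stackRun π z j),
      z (π (stackRun π z j), histCount (stackRun π z j) (π (stackRun π z j))))] := rfl

@[simp] lemma length_stackRun (j : ℕ) : (stackRun π z j).length = j := by
  induction j with
  | zero => rfl
  | succ j ih => simp [stackRun_succ, ih]

lemma histCount_stackRun_succ (j : ℕ) (a : Fin k) : histCount (stackRun π z (j + 1)) a =
    histCount (stackRun π z j) a + if π (stackRun π z j) = a then 1 else 0 := by
  simp [stackRun_succ, histCount_append, histCount_singleton]

lemma stackRun_prefix_of_le {i j : ℕ} (h : i ≤ j) : stackRun π z i <+: stackRun π z j := by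
  induction j, h using Nat.le_induction with
  | base => exact List.prefix_rfl
  | succ j _ ih => exact ih.trans (List.prefix_append _ _)

/-- Each play of `a` reads the next unused entry of its stack; empirical means thus become averages
of initial segments of a stack. -/
lemma map_snd_filter_stackRun (j : ℕ) (a : Fin k) :
    ((stackRun π z j).filter fun p => p.1 = a).map Prod.snd =
      (List.range (histCount (stackRun π z j) a)).map fun i => z (a, i) := by
  induction j with
  | zero => simp
  | succ j ih =>
    rw [histCount_stackRun_succ, stackRun_succ, List.filter_append, List.map_append, ih]
    by_cases h : π (stackRun π z j) = a
    · simp [h, List.range_succ]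
    · simp [h]

lemma histMean_stackRun (j : ℕ) (a : Fin k) : histMean (stackRun π z j) a =
    (∑ i ∈ Finset.range (histCount (stackRun π z j) a), z (a, i)) /
      histCount (stackRun π z j) a := by
  rw [histMean, map_snd_filter_stackRun, Finset.sum_range, ← List.sum_ofFn]
  congr 2
  apply List.ext_getElem <;> simp

/-- If an action has been played more than `u` times, it was selected after exactly `u` plays. -/
lemma exists_selected_of_lt_histCount {u N : ℕ} {a : Fin k}
    (h : u < histCount (stackRun π z N) a) :
    ∃ j < N, histCount (stackRun π z j) a = u ∧ π (stackRun π z j) = a := by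
  induction N with
  | zero => simp at h
  | succ N ih =>
    by_cases h' : u < histCount (stackRun π z N) a
    · obtain ⟨j, hj, hj'⟩ := ih h'
      exact ⟨j, hj.trans N.lt_succ_self, hj'⟩
    · rw [histCount_stackRun_succ] at h
      refine ⟨N, N.lt_succ_self, ?_⟩
      split_ifs at h with hs
      · exact ⟨by omega, hs⟩
      · omega

end StackRun

/-! ### The while loop on stacks -/

section Drain

variable {k : ℕ} (π : Policy k) (z : Fin k × ℕ → ℝ)

/-- The first index `j ≥ l` at which the action selected by `π` has used up the first `c a` rewards
of its stack. -/
noncomputable def drainIndex (c : Fin k → ℕ) (l : ℕ) : ℕ :=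
  sInf {j | l ≤ j ∧ c (π (stackRun π z j)) ≤ histCount (stackRun π z j) (π (stackRun π z j))}

/-- The leader has updated `π` with the first `l` steps of the run on the stacks `z`, and the queue
of action `a` holds those among the first `c a` rewards of its stack that are not yet used. -/
structure OnStack (S : LeaderState k) (l : ℕ) (c : Fin k → ℕ) : Prop where
  hist_eq : S.hist = stackRun π z l
  count_le : ∀ a, histCount S.hist a ≤ c a
  queue_eq : ∀ a, S.queue a =
    ((List.range (c a)).map fun i => z (a, i)).drop (histCount S.hist a)

variable {π z}

/-- Conservation: a known reward is either used or queued. -/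
lemma OnStack.length_queue {S : LeaderState k} {l : ℕ} {c : Fin k → ℕ} (h : OnStack π z S l c)
    (a : Fin k) : histCount S.hist a + (S.queue a).length = c a := by
  have := h.count_le a
  rw [h.queue_eq]
  simp
  omega

lemma OnStack.le_sum {S : LeaderState k} {l : ℕ} {c : Fin k → ℕ} (h : OnStack π z S l c) :
    l ≤ ∑ a, c a := by
  rw [← length_stackRun π z l, ← h.hist_eq, ← sum_histCount]
  exact Finset.sum_le_sum fun a _ => h.count_le a

lemma drain_of_nil {S : LeaderState k} (h : S.queue (π S.hist) = []) : drain π S = S := by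
  rw [drain]
  split
  · rfl
  · simp_all

lemma drain_of_cons {S : LeaderState k} {x : ℝ} {q : List ℝ}
    (h : S.queue (π S.hist) = x :: q) : drain π S =
      drain π ⟨S.hist ++ [(π S.hist, x)], Function.update S.queue (π S.hist) q⟩ := by
  rw [drain]
  split
  · simp_all
  · simp_all

/-- The head of the queue of the selected action is the next entry of its stack, so one pass of the
loop is one step of the run. The loop stops when the selected action has no known reward left, which
is the condition in `drainIndex`. -/
lemma OnStack.drain {S : LeaderState k} {l : ℕ} {c : Fin k → ℕ} (h : OnStack π z S l c) :
    OnStack π z (drain π S) (drainIndex π z c l) c := by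
  induction S using drain.induct π generalizing l with
  | case1 S hq =>
    rw [drain_of_nil hq]
    have hl := h.length_queue (π S.hist)
    rw [hq, h.hist_eq] at hl
    have : drainIndex π z c l = l := by
      refine le_antisymm (Nat.sInf_le ⟨le_rfl, by simpa using hl.ge⟩) ?_
      exact (Nat.sInf_mem ⟨l, le_rfl, by simpa using hl.ge⟩ : drainIndex π z c l ∈ _).1
    rwa [this]
  | case2 S x q hq ih =>
    rw [drain_of_cons hq]
    have hl := h.length_queue (π S.hist)
    have hlt : histCount S.hist (π S.hist) < c (π S.hist) := by
      rw [hq] at hl; simp at hl; omega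
    have hqe := h.queue_eq (π S.hist)
    rw [hq, List.drop_eq_getElem_cons (by simpa using hlt)] at hqe
    simp only [List.getElem_map, List.getElem_range, List.cons.injEq] at hqe
    -- The selected action still has an unused known reward, so `l` itself is not a stopping index.
    have hidx : drainIndex π z c l = drainIndex π z c (l + 1) := by
      unfold drainIndex
      congr 1
      ext j
      refine ⟨fun ⟨h1, h2⟩ => ⟨Nat.succ_le_of_lt (lt_of_le_of_ne h1 ?_), h2⟩,
        fun ⟨h1, h2⟩ => ⟨by omega, h2⟩⟩
      rintro rfl
      rw [← h.hist_eq] at h2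
      omega
    rw [hidx]
    refine ih ⟨?_, fun a => ?_, fun a => ?_⟩
    · rw [stackRun_succ, ← h.hist_eq, hqe.1]
    · rw [histCount_append, histCount_singleton]
      have := h.count_le a
      split_ifs with ha
      · subst ha; exact hlt
      · simpa using this
    · rw [histCount_append, histCount_singleton]
      by_cases ha : a = π S.hist
      · subst ha; simp [hqe.2]
      · simp [Function.update_of_ne ha, Ne.symm ha, h.queue_eq a]

lemma queue_drain_eq_nil (S : LeaderState k) :
    (drain π S).queue (π (drain π S).hist) = [] := by
  induction S using drain.induct π with
  | case1 S hq => rwa [drain_of_nil hq]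
  | case2 S x q hq ih => rwa [drain_of_cons hq]

/-- `hM` says that the new messages carry the next entries of every stack. -/
lemma OnStack.enqueue {S : LeaderState k} {l : ℕ} {c c' : Fin k → ℕ} (h : OnStack π z S l c)
    {M : List (Fin k × ℝ)}
    (hM : ∀ a, ((List.range (c' a)).map fun i => z (a, i)) =
      ((List.range (c a)).map fun i => z (a, i)) ++ (M.filter fun p => p.1 = a).map Prod.snd) :
    OnStack π z (enqueue M S) l c' := by
  refine ⟨h.hist_eq, fun a => ?_, fun a => ?_⟩
  · have := congrArg List.length (hM a)
    simp at this
    exact (h.count_le a).trans (by omega)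
  · simp only [Quack.enqueue]
    rw [hM, List.drop_append_of_le_length (by simpa using h.count_le a), h.queue_eq]

/-- With an empty queue, used and known rewards of the action coincide, so the leader's own reward
is next both in order of arrival and in the run. -/
lemma OnStack.play {S : LeaderState k} {l : ℕ} {c : Fin k → ℕ} (h : OnStack π z S l c)
    (hq : S.queue (π S.hist) = []) {x : ℝ} (hx : x = z (π S.hist, c (π S.hist))) :
    OnStack π z ⟨S.hist ++ [(π S.hist, x)], S.queue⟩ (l + 1)
      (fun a => c a + if π S.hist = a then 1 else 0) := by
  have hc := h.length_queue (π S.hist)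
  rw [hq] at hc
  simp only [List.length_nil, add_zero] at hc
  refine ⟨?_, fun a => ?_, fun a => ?_⟩
  · rw [stackRun_succ, ← h.hist_eq, hc, hx]
  · simpa [histCount_append, histCount_singleton] using h.count_le a
  · simp only [histCount_append, histCount_singleton]
    by_cases ha : π S.hist = a
    · subst ha; simp [hc, hq]
    · simp [ha, h.queue_eq a]

end Drain

/-! ### The order in which the rewards reach the leader -/

section Arrivals

variable {m : ℕ} (G : SimpleGraph (Fin m)) (v : Fin m)

open Classical in
/-- The plays `(s, w)` (round, agent) that are reported to the leader `v` in round `t`. -/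
noncomputable def arrivalsAt (t : ℕ) : List (ℕ × Fin m) :=
  ((List.finRange m).filter fun w => w ≠ v ∧ G.dist v w < t).map fun w => (t - G.dist v w, w)

/-- The plays known to the leader at the end of round `t`, in the order in which they reach the
leader. -/
noncomputable def arrived : ℕ → List (ℕ × Fin m)
  | 0 => []
  | t + 1 => arrived t ++ arrivalsAt G v (t + 1) ++ [(t + 1, v)]

lemma arrived_succ (t : ℕ) :
    arrived G v (t + 1) = arrived G v t ++ arrivalsAt G v (t + 1) ++ [(t + 1, v)] := rfl

lemma messages_eq {k : ℕ} (act : ℕ → Fin m → Fin k) (rew : ℕ → Fin m → ℝ) (t : ℕ) :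
    messages G v act rew t = (arrivalsAt G v t).map fun p => (act p.1 p.2, rew p.1 p.2) := by
  simp [messages, arrivalsAt]

variable {G v}

lemma mem_arrivalsAt {t s : ℕ} {w : Fin m} :
    (s, w) ∈ arrivalsAt G v t ↔ w ≠ v ∧ 1 ≤ s ∧ s + G.dist v w = t := by
  simp only [arrivalsAt, List.mem_map, List.mem_filter, List.mem_finRange, true_and,
    decide_eq_true_eq, Prod.mk.injEq]
  constructor
  · rintro ⟨w', ⟨h1, h2⟩, h3, rfl⟩
    exact ⟨h1, by omega, by omega⟩
  · rintro ⟨h1, h2, h3⟩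
    exact ⟨w, ⟨h1, by omega⟩, by omega, rfl⟩

lemma mem_arrived {t s : ℕ} {w : Fin m} :
    (s, w) ∈ arrived G v t ↔ 1 ≤ s ∧ s + G.dist v w ≤ t := by
  induction t with
  | zero => simp [arrived]; omega
  | succ t ih =>
    rw [arrived_succ]
    simp only [List.mem_append, ih, mem_arrivalsAt, List.mem_singleton, Prod.mk.injEq]
    constructor
    · rintro ((h | h) | ⟨rfl, rfl⟩)
      · omega
      · omega
      · simp
    · rintro ⟨h1, h2⟩
      by_cases hw : w = v
      · subst hw
        simp only [SimpleGraph.dist_self, add_zero] at h2 ⊢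
        by_cases hs : s = t + 1
        · exact Or.inr ⟨hs, trivial⟩
        · exact Or.inl (Or.inl ⟨h1, by omega⟩)
      · by_cases hs : s + G.dist v w = t + 1
        · exact Or.inl (Or.inr ⟨hw, h1, hs⟩)
        · exact Or.inl (Or.inl ⟨h1, by omega⟩)

lemma nodup_arrivalsAt (t : ℕ) : (arrivalsAt G v t).Nodup := by
  refine List.Nodup.map (fun w w' h => ?_) ((List.nodup_finRange m).filter _)
  exact congrArg Prod.snd h

lemma nodup_arrived (t : ℕ) : (arrived G v t).Nodup := by
  induction t with
  | zero => simp [arrived]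
  | succ t ih =>
    rw [arrived_succ, List.append_assoc]
    refine List.nodup_append'.2 ⟨ih, List.nodup_append'.2 ⟨nodup_arrivalsAt _, by simp, ?_⟩, ?_⟩
    · rintro ⟨s, w⟩ h h'
      simp only [List.mem_singleton, Prod.mk.injEq] at h'
      exact (mem_arrivalsAt.1 h).1 h'.2
    · rintro ⟨s, w⟩ h h'
      have h1 := mem_arrived.1 h
      rcases List.mem_append.1 h' with h' | h'
      · have := mem_arrivalsAt.1 h'; omega
      · simp only [List.mem_singleton, Prod.mk.injEq] at h'
        omega

lemma arrived_prefix_of_le {s t : ℕ} (h : s ≤ t) : arrived G v s <+: arrived G v t := by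
  induction t, h using Nat.le_induction with
  | base => exact List.prefix_rfl
  | succ t _ ih =>
    rw [arrived_succ, List.append_assoc]
    exact ih.trans (List.prefix_append _ _)

lemma append_arrivalsAt_prefix_arrived {s t : ℕ} (h : s + 1 ≤ t) :
    arrived G v s ++ arrivalsAt G v (s + 1) <+: arrived G v t :=
  (List.prefix_append _ _).trans (arrived_prefix_of_le h)

lemma length_arrived_le (t : ℕ) : (arrived G v t).length ≤ m * t := by
  classical
  rw [← List.toFinset_card_of_nodup (nodup_arrived t)]
  calc _ ≤ (Finset.Icc 1 t ×ˢ (Finset.univ : Finset (Fin m))).card := by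
        refine Finset.card_le_card ?_
        rintro ⟨s, w⟩ h
        have := mem_arrived.1 (List.mem_toFinset.1 h)
        simp only [Finset.mem_product, Finset.mem_Icc, Finset.mem_univ, and_true]
        omega
    _ = m * t := by simp [mul_comm]

lemma one_le_dist (hG : G.Connected) {w : Fin m} (hw : w ≠ v) : 1 ≤ G.dist v w :=
  hG.pos_dist_of_ne (Ne.symm hw)

/-- Causality: other agents are at distance at least `1`, so what the leader knows when it acts in
round `t + 1` dates from rounds up to `t`. -/
lemma round_le_of_mem_append (hG : G.Connected) {t s : ℕ} {w : Fin m}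
    (h : (s, w) ∈ arrived G v t ++ arrivalsAt G v (t + 1)) : 1 ≤ s ∧ s ≤ t := by
  rcases List.mem_append.1 h with h | h
  · have := mem_arrived.1 h; omega
  · have h' := mem_arrivalsAt.1 h
    have := one_le_dist hG h'.1
    omega

end Arrivals

/-! ### Rewards taken from stacks -/

section StackReward

variable {m k : ℕ} (G : SimpleGraph (Fin m)) (v : Fin m)

/-- The number of plays of action `a` in the list `L` of plays. -/
def playCount (act : ℕ → Fin m → Fin k) (L : List (ℕ × Fin m)) (a : Fin k) : ℕ :=
  (L.filter fun p => act p.1 p.2 = a).length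

/-- The position of the play `p` among the plays of the same action, in order of arrival. -/
noncomputable def stackRank (T : ℕ) (act : ℕ → Fin m → Fin k) (p : ℕ × Fin m) : ℕ :=
  ((arrived G v T).filter fun q => act q.1 q.2 = act p.1 p.2).idxOf p

/-- The rewards obtained if the plays of each action take their rewards from the stacks `z` in
order of arrival. -/
noncomputable def stackReward (T : ℕ) (act : ℕ → Fin m → Fin k) (z : Fin k × ℕ → ℝ) (s : ℕ)
    (w : Fin m) : ℝ :=
  z (act s w, stackRank G v T act (s, w))

variable {G v}

lemma playCount_append (act : ℕ → Fin m → Fin k) (L L' : List (ℕ × Fin m)) (a : Fin k) :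
    playCount act (L ++ L') a = playCount act L a + playCount act L' a := by
  simp [playCount]

lemma playCount_singleton (act : ℕ → Fin m → Fin k) (p : ℕ × Fin m) (a : Fin k) :
    playCount act [p] a = if act p.1 p.2 = a then 1 else 0 := by
  by_cases h : act p.1 p.2 = a <;> simp [playCount, h]

lemma playCount_congr {act act' : ℕ → Fin m → Fin k} {L : List (ℕ × Fin m)}
    (h : ∀ p ∈ L, act p.1 p.2 = act' p.1 p.2) : playCount act L = playCount act' L := by
  funext a
  unfold playCount
  rw [List.filter_congr fun p hp => by rw [h p hp]]

lemma sum_playCount (act : ℕ → Fin m → Fin k) (L : List (ℕ × Fin m)) :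
    ∑ a, playCount act L a = L.length :=
  sum_length_filter_eq (fun p : ℕ × Fin m => act p.1 p.2) L

/-- Filtering by action preserves prefixes, so the `i`-th play of `a` in `L` is also the `i`-th in
the full arrival list and has rank `i`. -/
lemma map_stackReward_filter {T : ℕ} {act : ℕ → Fin m → Fin k} {z : Fin k × ℕ → ℝ}
    {rew : ℕ → Fin m → ℝ} {L : List (ℕ × Fin m)} (hL : L <+: arrived G v T)
    (hrew : ∀ p ∈ L, rew p.1 p.2 = stackReward G v T act z p.1 p.2) (a : Fin k) :
    (L.filter fun p => act p.1 p.2 = a).map (fun p => rew p.1 p.2) =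
      (List.range (playCount act L a)).map fun i => z (a, i) := by
  have hpre := hL.filter (fun p => decide (act p.1 p.2 = a))
  apply List.ext_getElem
  · simp [playCount]
  · intro i h1 h2
    simp only [List.length_map] at h1
    have hmem := List.getElem_mem h1
    rw [List.mem_filter] at hmem
    simp only [List.getElem_map, List.getElem_range]
    rw [hrew _ hmem.1, stackReward, stackRank]
    have ha : act (L.filter fun p => act p.1 p.2 = a)[i].1
        (L.filter fun p => act p.1 p.2 = a)[i].2 = a := by simpa using hmem.2
    simp only [Prod.mk.eta, ha]
    have hnd := (nodup_arrived (G := G) (v := v) T).filter (fun p => decide (act p.1 p.2 = a))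
    rw [hpre.getElem h1, hnd.idxOf_getElem]

variable (G v) in
/-- The number of updates of `π` up to the end of round `t`, when the rewards come from the stacks
`z`. -/
noncomputable def runIndex (π : Policy k) (act : ℕ → Fin m → Fin k) (z : Fin k × ℕ → ℝ) : ℕ → ℕ
  | 0 => 0
  | t + 1 => drainIndex π z (playCount act (arrived G v t ++ arrivalsAt G v (t + 1)))
      (runIndex π act z t) + 1

variable (G v) in
/-- The action of the leader in round `t + 1`, when the rewards come from the stacks `z`. -/
noncomputable def stackAction (π : Policy k) (act : ℕ → Fin m → Fin k) (z : Fin k × ℕ → ℝ)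
    (t : ℕ) : Fin k :=
  π (stackRun π z (drainIndex π z (playCount act (arrived G v t ++ arrivalsAt G v (t + 1)))
    (runIndex G v π act z t)))

/-! ### The leader's memory as a run on the stacks -/

section OnStack

variable {π : Policy k} {act : ℕ → Fin m → Fin k} {z : Fin k × ℕ → ℝ} {rew : ℕ → Fin m → ℝ}
  {T : ℕ}

lemma onStack_drain_of_onStack {t : ℕ} (ht : t + 1 ≤ T)
    (hrew : ∀ p ∈ arrived G v (t + 1), rew p.1 p.2 = stackReward G v T act z p.1 p.2)
    (h : OnStack π z (leaderState G v π act rew t) (runIndex G v π act z t)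
      (playCount act (arrived G v t))) :
    OnStack π z
      (drain π (enqueue (messages G v act rew (t + 1)) (leaderState G v π act rew t)))
      (drainIndex π z (playCount act (arrived G v t ++ arrivalsAt G v (t + 1)))
        (runIndex G v π act z t))
      (playCount act (arrived G v t ++ arrivalsAt G v (t + 1))) := by
  refine (h.enqueue fun a => ?_).drain
  have h0 := fun p (hp : p ∈ arrived G v t ++ arrivalsAt G v (t + 1)) =>
    hrew p ((append_arrivalsAt_prefix_arrived le_rfl).subset hp)
  rw [← map_stackReward_filter (append_arrivalsAt_prefix_arrived ht) h0,
    ← map_stackReward_filter (arrived_prefix_of_le (by omega : t ≤ T))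
      (fun p hp => h0 p (List.mem_append_left _ hp)), List.filter_append, List.map_append,
    messages_eq, List.filter_map, List.map_map]
  rfl

/-- As long as the leader's plays agree with `act`, its memory follows the run of `π` on the
stacks. -/
lemma leaderState_onStack {t : ℕ} (ht : t ≤ T)
    (hrew : ∀ p ∈ arrived G v t, rew p.1 p.2 = stackReward G v T act z p.1 p.2)
    (hact : ∀ s < t, leaderAction G v π act rew (s + 1) = act (s + 1) v) :
    OnStack π z (leaderState G v π act rew t) (runIndex G v π act z t)
      (playCount act (arrived G v t)) := by
  induction t with
  | zero =>
    exact ⟨rfl, fun a => by simp [leaderState],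
      fun a => by simp [leaderState, arrived, playCount]⟩
  | succ t ih =>
    have hsub : arrived G v t ⊆ arrived G v (t + 1) := (arrived_prefix_of_le t.le_succ).subset
    have hS := onStack_drain_of_onStack ht hrew
      (ih (by omega) (fun p hp => hrew p (hsub hp)) fun s hs => hact s (by omega))
    have hlast := hact t t.lt_succ_self
    rw [leaderAction, Nat.add_sub_cancel] at hlast
    have hx : rew (t + 1) v = z (act (t + 1) v,
        playCount act (arrived G v t ++ arrivalsAt G v (t + 1)) (act (t + 1) v)) := by
      have h1 := map_stackReward_filter (arrived_prefix_of_le ht) hrew (act (t + 1) v)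
      have h2 := map_stackReward_filter (append_arrivalsAt_prefix_arrived ht) (fun p hp =>
        hrew p ((append_arrivalsAt_prefix_arrived le_rfl).subset hp)) (act (t + 1) v)
      rw [arrived_succ, List.filter_append, List.map_append, h2,
        playCount_append _ _ [(t + 1, v)], playCount_singleton] at h1
      simpa [List.range_succ] using h1
    have hplay := hS.play (queue_drain_eq_nil _) (x := rew (t + 1) v) (by rw [hlast]; exact hx)
    have hc : playCount act (arrived G v (t + 1)) = fun a =>
        playCount act (arrived G v t ++ arrivalsAt G v (t + 1)) a +
          if act (t + 1) v = a then 1 else 0 := by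
      funext a
      rw [arrived_succ, playCount_append, playCount_singleton]
    rw [hc, ← hlast]
    exact hplay

lemma leaderAction_eq_stackAction {t : ℕ} (ht : t + 1 ≤ T)
    (hrew : ∀ p ∈ arrived G v (t + 1), rew p.1 p.2 = stackReward G v T act z p.1 p.2)
    (hact : ∀ s < t, leaderAction G v π act rew (s + 1) = act (s + 1) v) :
    leaderAction G v π act rew (t + 1) = stackAction G v π act z t := by
  have hS := onStack_drain_of_onStack ht hrew (leaderState_onStack (by omega)
    (fun p hp => hrew p ((arrived_prefix_of_le t.le_succ).subset hp)) hact)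
  rw [leaderAction, Nat.add_sub_cancel, hS.hist_eq, stackAction]

/-- The two actions of a round are known to agree only if all earlier leader actions match `act`;
hence only the full conjunctions are compared, by induction on the round. This passes between
conditions on rewards and conditions on stacks. -/
lemma forall_leaderAction_iff {n : ℕ} (hn : n ≤ T)
    (hrew : ∀ p ∈ arrived G v n, rew p.1 p.2 = stackReward G v T act z p.1 p.2) :
    (∀ t < n, leaderAction G v π act rew (t + 1) = act (t + 1) v) ↔
      ∀ t < n, stackAction G v π act z t = act (t + 1) v := by
  have hr : ∀ t < n, ∀ p ∈ arrived G v (t + 1),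
      rew p.1 p.2 = stackReward G v T act z p.1 p.2 :=
    fun t ht p hp => hrew p ((arrived_prefix_of_le ht).subset hp)
  constructor
  · intro h t ht
    rw [← h t ht, leaderAction_eq_stackAction (by omega) (hr t ht) fun s hs => h s (by omega)]
  · intro h t
    induction t using Nat.strong_induction_on with
    | _ t ih =>
      intro ht
      rw [← h t ht, leaderAction_eq_stackAction (by omega) (hr t ht) fun s hs => ih s hs (by omega)]

end OnStack

/-- The run on the stacks depends on the actions of earlier rounds only. -/
lemma runIndex_congr (hG : G.Connected) {π : Policy k} {act act' : ℕ → Fin m → Fin k}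
    {z : Fin k × ℕ → ℝ} {t : ℕ} (h : ∀ s, 1 ≤ s → s < t → ∀ w, act s w = act' s w) :
    runIndex G v π act z t = runIndex G v π act' z t := by
  induction t with
  | zero => rfl
  | succ t ih =>
    rw [runIndex, runIndex, ih fun s h1 h2 => h s h1 (by omega), playCount_congr]
    rintro ⟨s, w⟩ hp
    have := round_le_of_mem_append hG hp
    exact h s this.1 (by omega) w

lemma stackAction_congr (hG : G.Connected) {π : Policy k} {act act' : ℕ → Fin m → Fin k}
    {z : Fin k × ℕ → ℝ} {t : ℕ} (h : ∀ s, 1 ≤ s → s ≤ t → ∀ w, act s w = act' s w) :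
    stackAction G v π act z t = stackAction G v π act' z t := by
  rw [stackAction, stackAction, runIndex_congr hG fun s h1 h2 => h s h1 h2.le, playCount_congr]
  rintro ⟨s, w⟩ hp
  have := round_le_of_mem_append hG hp
  exact h s this.1 this.2 w

/-- The stacks that produce given rewards. -/
noncomputable def stackOf (L : List (ℕ × Fin m)) (act : ℕ → Fin m → Fin k) (rew : ℕ → Fin m → ℝ)
    (q : Fin k × ℕ) : ℝ :=
  ((L.filter fun p => act p.1 p.2 = q.1)[q.2]?).elim 0 fun p => rew p.1 p.2

/-- Any rewards come from some stacks, so the stack lemmas apply to every sample path. -/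
lemma stackReward_stackOf {T : ℕ} {act : ℕ → Fin m → Fin k} {rew : ℕ → Fin m → ℝ} {s : ℕ}
    {w : Fin m} (h : (s, w) ∈ arrived G v T) :
    stackReward G v T act (stackOf (arrived G v T) act rew) s w = rew s w := by
  have hmem : (s, w) ∈ (arrived G v T).filter fun q => act q.1 q.2 = act s w := by simp [h]
  simp only [stackReward, stackOf, stackRank]
  rw [List.getElem?_eq_getElem (List.idxOf_lt_length_of_mem hmem), List.getElem_idxOf]
  rfl

/-- The plays up to round `t` determine the leader's memory at the end of round `t`. -/
lemma leaderState_congr {π : Policy k} {act act' : ℕ → Fin m → Fin k}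
    {rew rew' : ℕ → Fin m → ℝ} {t : ℕ} (ha : ∀ s, 1 ≤ s → s ≤ t → ∀ w, act s w = act' s w)
    (hr : ∀ s, 1 ≤ s → s ≤ t → ∀ w, rew s w = rew' s w) :
    leaderState G v π act rew t = leaderState G v π act' rew' t := by
  induction t with
  | zero => rfl
  | succ t ih =>
    have hM : messages G v act rew (t + 1) = messages G v act' rew' (t + 1) := by
      rw [messages_eq, messages_eq]
      refine List.map_congr_left ?_
      rintro ⟨s, w⟩ hp
      have := mem_arrivalsAt.1 hp
      rw [ha s (by omega) (by omega), hr s (by omega) (by omega)]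
    rw [leaderState, leaderState, hM, ih (fun s h1 h2 => ha s h1 (by omega))
      (fun s h1 h2 => hr s h1 (by omega)), hr (t + 1) (by omega) le_rfl]

lemma leaderAction_congr (hG : G.Connected) {π : Policy k} {act act' : ℕ → Fin m → Fin k}
    {rew rew' : ℕ → Fin m → ℝ} {t : ℕ} (ha : ∀ s, 1 ≤ s → s ≤ t → ∀ w, act s w = act' s w)
    (hr : ∀ s, 1 ≤ s → s ≤ t → ∀ w, rew s w = rew' s w) :
    leaderAction G v π act rew (t + 1) = leaderAction G v π act' rew' (t + 1) := by
  have hM : messages G v act rew (t + 1) = messages G v act' rew' (t + 1) := by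
    rw [messages_eq, messages_eq]
    refine List.map_congr_left ?_
    rintro ⟨s, w⟩ hp
    have := round_le_of_mem_append hG (List.mem_append_right _ hp)
    rw [ha s (by omega) (by omega), hr s (by omega) (by omega)]
  rw [leaderAction, leaderAction, hM, Nat.add_sub_cancel, leaderState_congr ha hr]

end StackReward

/-! ### Plays that have not reached the bandit algorithm -/

section Counting

variable {m k : ℕ} {G : SimpleGraph (Fin m)} {v : Fin m} {π : Policy k}
  {act : ℕ → Fin m → Fin k} {rew : ℕ → Fin m → ℝ}

lemma hist_prefix_drain (S : LeaderState k) : S.hist <+: (drain π S).hist := by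
  induction S using drain.induct π with
  | case1 S hq => rw [drain_of_nil hq]
  | case2 S x q hq ih =>
    rw [drain_of_cons hq]
    exact (List.prefix_append _ _).trans ih

lemma hist_leaderState_prefix_of_le {s t : ℕ} (h : s ≤ t) :
    (leaderState G v π act rew s).hist <+: (leaderState G v π act rew t).hist := by
  induction t, h using Nat.le_induction with
  | base => exact List.prefix_rfl
  | succ t _ ih =>
    refine ih.trans (List.IsPrefix.trans ?_ (List.prefix_append _ _))
    exact hist_prefix_drain (enqueue (messages G v act rew (t + 1)) (leaderState G v π act rew t))

/-- When the leader has just played an action, every known reward of this action has been used. -/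
lemma playCount_arrived_eq_histCount {s : ℕ} {a : Fin k} (hs : s = 0 ∨ act s v = a)
    (hact : ∀ t < s, leaderAction G v π act rew (t + 1) = act (t + 1) v) :
    playCount act (arrived G v s) a = histCount (leaderState G v π act rew s).hist a := by
  have hS := leaderState_onStack (T := s) (z := stackOf (arrived G v s) act rew) le_rfl
    (fun p hp => (stackReward_stackOf hp).symm) hact
  have hq : (leaderState G v π act rew s).queue a = [] := by
    cases s with
    | zero => rfl
    | succ s =>
      have ha := hact s s.lt_succ_self
      rw [hs.resolve_left s.succ_ne_zero, leaderAction, Nat.add_sub_cancel] at ha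
      subst ha
      exact queue_drain_eq_nil _
  simpa [hq] using (hS.length_queue a).symm

/-- All but `2 ∑ w, d_{vw}` of the plays of an action have been used by the bandit algorithm. -/
lemma sum_card_plays_le {n : ℕ}
    (hact : ∀ t < n, leaderAction G v π act rew (t + 1) = act (t + 1) v)
    (hfol : ∀ t, 1 ≤ t → t ≤ n → ∀ w, w ≠ v → G.dist v w < t → act t w = act (t - G.dist v w) v)
    (a : Fin k) :
    ∑ w, ((Finset.Icc 1 n).filter fun t => act t w = a).card ≤
      histCount (leaderState G v π act rew n).hist a + 2 * ∑ w, G.dist v w := by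
  -- `s` is the last round in which the leader plays `a`, or `0` if there is none.
  classical
  obtain ⟨s, hsn, hs, hmax⟩ : ∃ s ≤ n, (s = 0 ∨ act s v = a) ∧
      ∀ t, 1 ≤ t → t ≤ n → act t v = a → t ≤ s := by
    let F := insert 0 ((Finset.Icc 1 n).filter fun t => act t v = a)
    have hF : F.Nonempty := ⟨0, Finset.mem_insert_self _ _⟩
    have hm := F.max'_mem hF
    refine ⟨F.max' hF, ?_, ?_, fun t h1 h2 h3 => F.le_max' t ?_⟩
    · rcases Finset.mem_insert.1 hm with h | h
      · omega
      · exact (Finset.mem_Icc.1 (Finset.mem_filter.1 h).1).2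
    · rcases Finset.mem_insert.1 hm with h | h
      · exact Or.inl h
      · exact Or.inr (Finset.mem_filter.1 h).2
    · exact Finset.mem_insert_of_mem (Finset.mem_filter.2 ⟨Finset.mem_Icc.2 ⟨h1, h2⟩, h3⟩)
  have hused : ∑ w, ((Finset.Icc 1 n).filter fun t => act t w = a ∧ t + G.dist v w ≤ s).card ≤
      histCount (leaderState G v π act rew n).hist a := by
    refine le_trans ?_ (histCount_mono (hist_leaderState_prefix_of_le hsn) a)
    rw [← playCount_arrived_eq_histCount hs fun t ht => hact t (by omega), ← Finset.card_sigma]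
    refine le_trans ?_ (List.toFinset_card_le _)
    refine Finset.card_le_card_of_injOn (fun p => (p.2, p.1)) ?_ ?_
    · rintro ⟨w, t⟩ h
      simp only [Finset.coe_sigma, Set.mem_sigma_iff, Finset.mem_coe, Finset.mem_filter,
        Finset.mem_Icc] at h
      simp only [Finset.mem_coe, List.mem_toFinset, List.mem_filter, mem_arrived,
        decide_eq_true_eq]
      exact ⟨⟨h.2.1.1, h.2.2.2⟩, h.2.2.1⟩
    · rintro ⟨w, t⟩ _ ⟨w', t'⟩ _ h
      simp only [Prod.mk.injEq] at h
      obtain ⟨rfl, rfl⟩ := h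
      rfl
  have hrest : ∀ w, ((Finset.Icc 1 n).filter
      fun t => act t w = a ∧ ¬ t + G.dist v w ≤ s).card ≤ 2 * G.dist v w := by
    intro w
    calc _ ≤ (Finset.Ioc (s - G.dist v w) (s + G.dist v w)).card := by
          refine Finset.card_le_card fun t ht => ?_
          simp only [Finset.mem_filter, Finset.mem_Icc] at ht
          obtain ⟨⟨h1, h2⟩, h3, h4⟩ := ht
          rw [Finset.mem_Ioc]
          refine ⟨by omega, ?_⟩
          by_cases hw : w = v
          · subst hw
            exact (hmax t h1 h2 h3).trans (Nat.le_add_right _ _)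
          -- A copied play stems from a leader's play of `a` in round `t - d`, which is at most `s`;
          -- a random play has `t ≤ d`.
          · by_cases hd : G.dist v w < t
            · have := hmax (t - G.dist v w) (by omega) (by omega)
                ((hfol t h1 h2 w hw hd).symm.trans h3)
              omega
            · omega
      _ ≤ _ := by rw [Nat.card_Ioc]; omega
  calc _ = ∑ w, (((Finset.Icc 1 n).filter fun t => act t w = a ∧ t + G.dist v w ≤ s).card +
        ((Finset.Icc 1 n).filter fun t => act t w = a ∧ ¬ t + G.dist v w ≤ s).card) := by
        refine Finset.sum_congr rfl fun w _ => ?_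
        rw [← Finset.card_filter_add_card_filter_not
          (s := (Finset.Icc 1 n).filter fun t => act t w = a)
          (fun t => t + G.dist v w ≤ s), Finset.filter_filter, Finset.filter_filter]
    _ ≤ _ := by
        rw [Finset.sum_add_distrib, Finset.mul_sum]
        exact add_le_add hused (Finset.sum_le_sum fun w _ => hrest w)

end Counting

/-! ### Measurability of the run on stacks -/

section Measurability

variable {k : ℕ} {π : Policy k}

lemma measurable_apply_of_countable {ι : Type*} [Countable ι] [MeasurableSpace ι]
    [MeasurableSingletonClass ι] {i : (ι → ℝ) → ι} (hi : Measurable i) :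
    Measurable fun z : ι → ℝ => z (i z) :=
  (measurable_from_prod_countable_left (f := fun p : (ι → ℝ) × ι => p.1 p.2)
    fun j => measurable_pi_apply j).comp (measurable_id.prodMk hi)

/-- Measurability of `π` is given on arrays of fixed length, so the run is represented by arrays.
The counts join the induction because they locate the next stack entry. -/
lemma exists_measurable_stackRun
    (hπ : ∀ s : ℕ, Measurable fun h : Fin s → Fin k × ℝ => π (List.ofFn h)) (j : ℕ) :
    ∃ g : (Fin k × ℕ → ℝ) → Fin j → Fin k × ℝ, Measurable g ∧
      (∀ z, stackRun π z j = List.ofFn (g z)) ∧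
      ∀ a, Measurable fun z => histCount (stackRun π z j) a := by
  induction j with
  | zero => exact ⟨fun _ => Fin.elim0, measurable_const, by simp, by simp⟩
  | succ j ih =>
    obtain ⟨g, hg, hrun, hcount⟩ := ih
    have hb : Measurable fun z => π (stackRun π z j) := by
      simp only [hrun]; exact (hπ j).comp hg
    have hc : Measurable fun z => histCount (stackRun π z j) (π (stackRun π z j)) :=
      (measurable_from_prod_countable_left
        (f := fun p : (Fin k × ℕ → ℝ) × Fin k => histCount (stackRun π p.1 j) p.2)
        hcount).comp (measurable_id.prodMk hb)
    refine ⟨fun z => Fin.snoc (α := fun _ => Fin k × ℝ) (g z) (π (stackRun π z j),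
      z (π (stackRun π z j), histCount (stackRun π z j) (π (stackRun π z j)))), ?_, ?_, ?_⟩
    · refine measurable_pi_lambda _ fun i => ?_
      refine Fin.lastCases ?_ (fun i => ?_) i
      · simpa only [Fin.snoc_last] using
          hb.prodMk (measurable_apply_of_countable (hb.prodMk hc))
      · simp only [Fin.snoc_castSucc]; exact (measurable_pi_apply i).comp hg
    · intro z
      rw [stackRun_succ, List.ofFn_succ']
      simp [hrun]
    · intro a
      simp only [histCount_stackRun_succ]
      exact (hcount a).add (Measurable.ite (hb (measurableSet_singleton a)) measurable_const
        measurable_const)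

lemma measurable_select_stackRun
    (hπ : ∀ s : ℕ, Measurable fun h : Fin s → Fin k × ℝ => π (List.ofFn h))
    (j : ℕ) : Measurable fun z => π (stackRun π z j) := by
  obtain ⟨g, hg, hrun, -⟩ := exists_measurable_stackRun hπ j
  simp only [hrun]; exact (hπ j).comp hg

lemma measurable_histCount_stackRun
    (hπ : ∀ s : ℕ, Measurable fun h : Fin s → Fin k × ℝ => π (List.ofFn h))
    (j : ℕ) (a : Fin k) :
    Measurable fun z => histCount (stackRun π z j) a :=
  (exists_measurable_stackRun hπ j).choose_spec.2.2 a

lemma measurable_sInf_nat {β : Type*} [MeasurableSpace β] {p : ℕ → β → Prop}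
    (hp : ∀ j, MeasurableSet {z | p j z}) : Measurable fun z => sInf {j | p j z} := by
  refine measurable_to_countable' fun y => ?_
  -- The second set accounts for `sInf ∅ = 0`.
  have : (fun z => sInf {j | p j z}) ⁻¹' {y} =
      ({z | p y z} ∩ ⋂ i, ⋂ (_ : i < y), {z | p i z}ᶜ) ∪ ({z | y = 0} ∩ ⋂ i, {z | p i z}ᶜ) := by
    ext z
    simp only [Set.mem_preimage, Set.mem_singleton_iff, Set.mem_union, Set.mem_inter_iff,
      Set.mem_ofPred_eq, Set.mem_iInter, Set.mem_compl_iff]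
    constructor
    · rintro rfl
      by_cases h : ∃ j, p j z
      · exact Or.inl ⟨Nat.sInf_mem h, fun i hi => Nat.notMem_of_lt_sInf hi⟩
      · push Not at h
        exact Or.inr ⟨by simp [h], h⟩
    · rintro (⟨h1, h2⟩ | ⟨rfl, h⟩)
      · refine le_antisymm (Nat.sInf_le h1) (not_lt.1 fun hlt => h2 _ hlt ?_)
        exact Nat.sInf_mem (s := {j | p j z}) ⟨y, h1⟩
      · simp [h]
  rw [this]
  refine ((hp y).inter (.iInter fun i => .iInter fun _ => (hp i).compl)).union
    ((MeasurableSet.const _).inter (.iInter fun i => (hp i).compl))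

lemma measurable_drainIndex
    (hπ : ∀ s : ℕ, Measurable fun h : Fin s → Fin k × ℝ => π (List.ofFn h))
    (c : Fin k → ℕ) {l : (Fin k × ℕ → ℝ) → ℕ} (hl : Measurable l) :
    Measurable fun z => drainIndex π z c (l z) := by
  refine measurable_sInf_nat fun j => ?_
  have hb := measurable_select_stackRun hπ j
  have hc : Measurable fun z => histCount (stackRun π z j) (π (stackRun π z j)) :=
    (measurable_from_prod_countable_left
      (f := fun p : (Fin k × ℕ → ℝ) × Fin k => histCount (stackRun π p.1 j) p.2)
      (measurable_histCount_stackRun hπ j)).comp (measurable_id.prodMk hb)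
  exact (measurableSet_le hl measurable_const).inter
    (measurableSet_le ((measurable_of_countable c).comp hb) hc)

lemma measurable_runIndex
    (hπ : ∀ s : ℕ, Measurable fun h : Fin s → Fin k × ℝ => π (List.ofFn h))
    {m : ℕ} (G : SimpleGraph (Fin m)) (v : Fin m)
    (act : ℕ → Fin m → Fin k) (t : ℕ) : Measurable fun z => runIndex G v π act z t := by
  induction t with
  | zero => exact measurable_const
  | succ t ih => exact (measurable_drainIndex hπ _ ih).add measurable_const

lemma measurable_stackAction
    (hπ : ∀ s : ℕ, Measurable fun h : Fin s → Fin k × ℝ => π (List.ofFn h))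
    {m : ℕ} (G : SimpleGraph (Fin m)) (v : Fin m)
    (act : ℕ → Fin m → Fin k) (t : ℕ) : Measurable fun z => stackAction G v π act z t :=
  (measurable_from_prod_countable_left
    (f := fun p : (Fin k × ℕ → ℝ) × ℕ => π (stackRun π p.1 p.2))
    (measurable_select_stackRun hπ)).comp
    (measurable_id.prodMk (measurable_drainIndex hπ _ (measurable_runIndex hπ G v act t)))

lemma measurable_histCount_runIndex
    (hπ : ∀ s : ℕ, Measurable fun h : Fin s → Fin k × ℝ => π (List.ofFn h))
    {m : ℕ} (G : SimpleGraph (Fin m)) (v : Fin m)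
    (act : ℕ → Fin m → Fin k) (t : ℕ) (a : Fin k) :
    Measurable fun z => histCount (stackRun π z (runIndex G v π act z t)) a :=
  (measurable_from_prod_countable_left
    (f := fun p : (Fin k × ℕ → ℝ) × ℕ => histCount (stackRun π p.1 p.2) a)
    (fun j => measurable_histCount_stackRun hπ j a)).comp
    (measurable_id.prodMk (measurable_runIndex hπ G v act t))

end Measurability

/-! ### The joint law of actions and rewards -/

/-- The product measure comes from the greatest outer measure bounded on rectangles by the product
of the side measures, so a bound on rectangles extends to all measurable sets. -/
lemma le_smul_pi_of_forall_rect {ι : Type*} [Fintype ι] {ρ : Measure (ι → ℝ)}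
    {μ : ι → Measure ℝ} {c : ℝ≥0∞} (hc0 : c ≠ 0) (hct : c ≠ ⊤)
    (h : ∀ B : ι → Set ℝ, (∀ i, MeasurableSet (B i)) →
      ρ (Set.univ.pi B) ≤ c * ∏ i, μ i (B i)) :
    ρ ≤ c • Measure.pi μ := by
  have hle : (c⁻¹ • ρ).toOuterMeasure ≤ OuterMeasure.pi fun i => (μ i).toOuterMeasure := by
    rw [OuterMeasure.le_pi]
    intro B _
    calc (c⁻¹ • ρ) (Set.univ.pi B)
        ≤ (c⁻¹ • ρ) (Set.univ.pi fun i => toMeasurable (μ i) (B i)) :=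
          measure_mono (Set.pi_mono fun i _ => subset_toMeasurable _ _)
      _ ≤ c⁻¹ * (c * ∏ i, μ i (toMeasurable (μ i) (B i))) := by
          rw [Measure.smul_apply, smul_eq_mul]
          gcongr
          exact h _ fun i => measurableSet_toMeasurable _ _
      _ = ∏ i, μ i (B i) := by
          rw [← mul_assoc, ENNReal.inv_mul_cancel hc0 hct, one_mul]
          simp
  refine Measure.le_iff.2 fun s hs => ?_
  have hs' := hle s
  rw [Measure.smul_apply, smul_eq_mul, Measure.pi_def, toMeasure_apply _ _ hs]
  calc ρ s = c * (c⁻¹ * ρ s) := by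
        rw [← mul_assoc, ENNReal.mul_inv_cancel hc0 hct, one_mul]
    _ ≤ _ := by gcongr; exact hs'

section Law

variable {m k n : ℕ} {Ω : Type*} {A : ℕ → Fin m → Ω → Fin k} {X : ℕ → Fin m → Ω → ℝ}

lemma measurableSet_past_action {s t : ℕ} (h1 : 1 ≤ s) (h2 : s < t) (w : Fin m) (a : Fin k) :
    MeasurableSet[past A X t] {ω | A s w ω = a} := by
  have hle : MeasurableSpace.comap (A s w) inferInstance ≤ past A X t :=
    le_trans (le_trans le_sup_left (le_iSup (fun w => MeasurableSpace.comap (A s w) inferInstance ⊔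
      MeasurableSpace.comap (X s w) inferInstance) w))
      (le_iSup₂ (f := fun s (_ : s ∈ Finset.Ico 1 t) => ⨆ w : Fin m,
        (MeasurableSpace.comap (A s w) inferInstance ⊔
          MeasurableSpace.comap (X s w) inferInstance)) s (Finset.mem_Ico.2 ⟨h1, h2⟩))
  exact hle _ ⟨{a}, measurableSet_singleton a, rfl⟩

lemma measurableSet_past_reward {s t : ℕ} (h1 : 1 ≤ s) (h2 : s < t) (w : Fin m) {B : Set ℝ}
    (hB : MeasurableSet B) : MeasurableSet[past A X t] {ω | X s w ω ∈ B} := by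
  have hle : MeasurableSpace.comap (X s w) inferInstance ≤ past A X t :=
    le_trans (le_trans le_sup_right (le_iSup (fun w => MeasurableSpace.comap (A s w) inferInstance ⊔
      MeasurableSpace.comap (X s w) inferInstance) w))
      (le_iSup₂ (f := fun s (_ : s ∈ Finset.Ico 1 t) => ⨆ w : Fin m,
        (MeasurableSpace.comap (A s w) inferInstance ⊔
          MeasurableSpace.comap (X s w) inferInstance)) s (Finset.mem_Ico.2 ⟨h1, h2⟩))
  exact hle _ ⟨B, hB, rfl⟩

variable [MeasurableSpace Ω] {ν : Measure Ω} {P : Fin k → Measure ℝ} {G : SimpleGraph (Fin m)}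
  {v : Fin m} {π : Policy k}

/-- Condition round by round: the rewards contribute the product of the `P`, the randomizing
followers the power of `1/k`. Dropping the constraints on the other agents' actions leaves only an
inequality. -/
lemma measure_plays_le [IsProbabilityMeasure ν] (hEnv : IsBanditInteraction ν P n A X)
    (hQ : IsQuack ν G v π n A X) (α : ℕ → Fin m → Fin k) (B : ℕ → Fin m → Set ℝ)
    (hB : ∀ s w, MeasurableSet (B s w)) {j : ℕ} (hj : j ≤ n) :
    ν {ω | ∀ s < j, ∀ w, A (s + 1) w ω = α (s + 1) w ∧ X (s + 1) w ω ∈ B (s + 1) w} ≤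
      ∏ s ∈ Finset.range j,
        (((k : ℝ≥0∞)⁻¹) ^ (Finset.univ.filter fun w => w ≠ v ∧ s + 1 ≤ G.dist v w).card *
          ∏ w, P (α (s + 1) w) (B (s + 1) w)) := by
  induction j with
  | zero => simp
  | succ j ih =>
    set E : Set Ω := {ω | ∀ s < j, ∀ w, A (s + 1) w ω = α (s + 1) w ∧ X (s + 1) w ω ∈ B (s + 1) w}
      with hE
    have hEm : MeasurableSet[past A X (j + 1)] E := by
      have : E = ⋂ s, ⋂ (_ : s < j), ⋂ w, ({ω | A (s + 1) w ω = α (s + 1) w} ∩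
          {ω | X (s + 1) w ω ∈ B (s + 1) w}) := by
        ext ω; simp [hE]
      rw [this]
      exact .iInter fun s => .iInter fun hs => .iInter fun w =>
        (measurableSet_past_action (by omega) (by omega) w _).inter
          (measurableSet_past_reward (by omega) (by omega) w (hB _ _))
    have hmem : j + 1 ∈ Finset.Icc 1 n := Finset.mem_Icc.2 ⟨by omega, hj⟩
    have hset : {ω | ∀ s < j + 1, ∀ w, A (s + 1) w ω = α (s + 1) w ∧
        X (s + 1) w ω ∈ B (s + 1) w} =
        E ∩ {ω | ∀ w, A (j + 1) w ω = α (j + 1) w} ∩ {ω | ∀ w, X (j + 1) w ω ∈ B (j + 1) w} := by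
      ext ω
      simp only [hE, Set.mem_ofPred_eq, Set.mem_inter_iff]
      constructor
      · intro h
        exact ⟨⟨fun s hs => h s (by omega), fun w => (h j (by omega) w).1⟩,
          fun w => (h j (by omega) w).2⟩
      · rintro ⟨⟨h1, h2⟩, h3⟩ s hs w
        rcases Nat.lt_succ_iff_lt_or_eq.1 hs with hs | rfl
        · exact h1 s hs w
        · exact ⟨h2 w, h3 w⟩
    rw [hset, hEnv.reward_law _ hmem E hEm _ _ fun w => hB _ w, Finset.prod_range_succ,
      ← mul_assoc]
    gcongr
    calc ν (E ∩ {ω | ∀ w, A (j + 1) w ω = α (j + 1) w})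
        ≤ ν (E ∩ {ω | ∀ w, w ≠ v → j + 1 ≤ G.dist v w → A (j + 1) w ω = α (j + 1) w}) :=
          measure_mono (Set.inter_subset_inter_right _ fun ω h w _ _ => h w)
      _ = _ := hQ.uniform _ hmem E hEm _
      _ ≤ _ := by gcongr; exact ih (by omega)

end Law

/-! ### Arrays of plays -/

section Extend

variable {m n : ℕ} {β : Type*}

/-- Extend an array indexed by the rounds `1, …, n` and the agents to all rounds. -/
def extend (hn : 1 ≤ n) (f : Fin n × Fin m → β) (s : ℕ) (w : Fin m) : β :=
  f (⟨min (s - 1) (n - 1), by omega⟩, w)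

lemma extend_succ (hn : 1 ≤ n) (f : Fin n × Fin m → β) (i : Fin n) (w : Fin m) :
    extend hn f (i + 1) w = f (i, w) := by
  unfold extend
  congr 2
  ext
  simp
  omega

lemma extend_eq (hn : 1 ≤ n) (f : Fin n × Fin m → β) {s : ℕ} (h1 : 1 ≤ s) (h2 : s ≤ n)
    (w : Fin m) : extend hn f s w = f (⟨s - 1, by omega⟩, w) := by
  unfold extend
  congr 2
  ext
  simp
  omega

end Extend

/-! ### Change of measure from the network to the stacks -/

section Compare

variable {m k n : ℕ} {Ω : Type*} [MeasurableSpace Ω] {ν : Measure Ω} {P : Fin k → Measure ℝ}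
  {A : ℕ → Fin m → Ω → Fin k} {X : ℕ → Fin m → Ω → ℝ} {G : SimpleGraph (Fin m)} {v : Fin m}
  {π : Policy k}

/-- The positions of the array at which followers play at random. -/
noncomputable def freePlays (n : ℕ) (G : SimpleGraph (Fin m)) (v : Fin m) :
    Finset (Fin n × Fin m) :=
  Finset.univ.filter fun p => p.2 ≠ v ∧ (p.1 : ℕ) + 1 ≤ G.dist v p.2

lemma card_freePlays : (freePlays n G v).card =
    ∑ s ∈ Finset.range n, (Finset.univ.filter fun w => w ≠ v ∧ s + 1 ≤ G.dist v w).card := by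
  rw [freePlays, Finset.card_filter, Fintype.sum_prod_type, Finset.sum_range]
  simp only [Finset.card_filter]

/-- The joint law of actions and rewards is dominated by a product measure on the event that the
actions are `α`. -/
lemma map_restrict_le [IsProbabilityMeasure ν] (hn : 1 ≤ n) (hk : k ≠ 0)
    (hEnv : IsBanditInteraction ν P n A X)
    (hQ : IsQuack ν G v π n A X) (α : Fin n × Fin m → Fin k) :
    (ν.restrict {ω | ∀ p : Fin n × Fin m, A (p.1 + 1) p.2 ω = α p}).map
        (fun ω (p : Fin n × Fin m) => X (p.1 + 1) p.2 ω) ≤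
      ((k : ℝ≥0∞)⁻¹ ^ (freePlays n G v).card) • Measure.pi fun p => P (α p) := by
  have hX : Measurable fun ω (p : Fin n × Fin m) => X (p.1 + 1) p.2 ω :=
    measurable_pi_lambda _ fun p => hEnv.measurable_reward _ (by simp) _
  refine le_smul_pi_of_forall_rect (pow_ne_zero _ (by simp)) (by simp [hk]) fun B hB => ?_
  have hm : MeasurableSet (Set.univ.pi B) := MeasurableSet.univ_pi hB
  rw [Measure.map_apply hX hm, Measure.restrict_apply (hX hm)]
  have key := measure_plays_le hEnv hQ (extend hn α) (extend hn B)
    (fun s w => hB _) le_rfl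
  refine le_trans (measure_mono ?_) (key.trans_eq ?_)
  · rintro ω ⟨h1, h2⟩ s hs w
    have e1 := extend_succ hn α ⟨s, hs⟩ w
    have e2 := extend_succ hn B ⟨s, hs⟩ w
    simp only at e1 e2
    rw [e1, e2]
    exact ⟨h2 (⟨s, hs⟩, w), h1 (⟨s, hs⟩, w) trivial⟩
  · rw [Finset.prod_mul_distrib, Finset.prod_pow_eq_pow_sum, card_freePlays, Finset.prod_range,
      Fintype.prod_prod_type]
    simp only [extend_succ]

/-- The actions `act` are compatible with the rules for the followers, and with the rewards on the
stacks `z`. -/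
def Consistent (G : SimpleGraph (Fin m)) (v : Fin m) (π : Policy k) (n : ℕ)
    (act : ℕ → Fin m → Fin k) (z : Fin k × ℕ → ℝ) : Prop :=
  (∀ t, 1 ≤ t → t ≤ n → ∀ w, w ≠ v → G.dist v w < t → act t w = act (t - G.dist v w) v) ∧
    ∀ t < n, stackAction G v π act z t = act (t + 1) v

/-- Induction on rounds: the leader's action is determined by the stacks and earlier actions, a
copying follower's by an earlier action of the leader, and the rest are free plays. -/
lemma Consistent.eq (hG : G.Connected) (hn : 1 ≤ n) {α α' : Fin n × Fin m → Fin k}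
    {z : Fin k × ℕ → ℝ} (h : Consistent G v π n (extend hn α) z)
    (h' : Consistent G v π n (extend hn α') z) (hfree : ∀ p ∈ freePlays n G v, α p = α' p) :
    α = α' := by
  have key : ∀ t, 1 ≤ t → t ≤ n → ∀ w, extend hn α t w = extend hn α' t w := by
    intro t
    induction t using Nat.strong_induction_on with
    | _ t ih =>
      intro h1 h2 w
      by_cases hw : w = v
      · subst hw
        obtain ⟨t, rfl⟩ := Nat.exists_eq_add_of_le' h1
        rw [← h.2 t (by omega), ← h'.2 t (by omega)]
        exact stackAction_congr hG fun s hs1 hs2 => ih s (by omega) hs1 (by omega)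
      · have hd := one_le_dist hG hw
        by_cases hdt : G.dist v w < t
        · rw [h.1 t h1 h2 w hw hdt, h'.1 t h1 h2 w hw hdt]
          exact ih _ (by omega) (by omega) (by omega) v
        · rw [extend_eq hn _ h1 h2, extend_eq hn _ h1 h2]
          refine hfree _ ?_
          simp only [freePlays, Finset.mem_filter, Finset.mem_univ, true_and]
          exact ⟨hw, by omega⟩
  funext ⟨i, w⟩
  simpa [extend_succ] using key (i + 1) (by omega) (by omega) w

lemma card_consistent_le (hG : G.Connected) (hn : 1 ≤ n) (z : Fin k × ℕ → ℝ) :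
    {α : Fin n × Fin m → Fin k | Consistent G v π n (extend hn α) z}.ncard ≤
      k ^ (freePlays n G v).card := by
  classical
  rw [← Nat.card_coe_set_eq]
  calc _ ≤ Nat.card (freePlays n G v → Fin k) := by
        refine Nat.card_le_card_of_injective (fun α p => α.1 p.1) fun α α' h => ?_
        exact Subtype.ext (α.2.eq hG hn α'.2 fun p hp => congrFun h ⟨p, hp⟩)
    _ = _ := by simp

/-- The slot of the stacks from which a play takes its reward. -/
noncomputable def slot (G : SimpleGraph (Fin m)) (v : Fin m) (T : ℕ) (hn : 1 ≤ n)
    (α : Fin n × Fin m → Fin k) (p : Fin n × Fin m) : Fin k × ℕ :=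
  (α p, stackRank G v T (extend hn α) (p.1 + 1, p.2))

/-- By round `T` every play of the first `n` rounds has been reported, so its rank is a genuine
position in a list without repetitions. -/
lemma slot_injective {T : ℕ} (hn : 1 ≤ n) (hT : ∀ w, n + G.dist v w ≤ T)
    (α : Fin n × Fin m → Fin k) : Function.Injective (slot G v T hn α) := by
  rintro ⟨i, w⟩ ⟨i', w'⟩ h
  simp only [slot, Prod.mk.injEq, stackRank, extend_succ] at h
  have hmem : ((i : ℕ) + 1, w) ∈ (arrived G v T).filter fun q =>
      extend hn α q.1 q.2 = α (i, w) := by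
    have := hT w
    simp only [List.mem_filter, mem_arrived, extend_succ, decide_true, and_true]
    omega
  rw [← h.1, List.idxOf_inj hmem] at h
  simp only [Prod.mk.injEq, Nat.add_right_cancel_iff, Fin.val_inj] at h ⊢
  exact h.2

lemma extend_comp_slot {T : ℕ} (hn : 1 ≤ n) (α : Fin n × Fin m → Fin k) (z : Fin k × ℕ → ℝ)
    {s : ℕ} (h1 : 1 ≤ s) (h2 : s ≤ n) (w : Fin m) :
    extend hn (fun p => z (slot G v T hn α p)) s w = stackReward G v T (extend hn α) z s w := by
  rw [extend_eq hn _ h1 h2, slot, stackReward, extend_eq hn α h1 h2]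
  simp only [Nat.sub_add_cancel h1]

lemma map_slot_infinitePi [∀ a, IsProbabilityMeasure (P a)] {T : ℕ} (hn : 1 ≤ n)
    (hT : ∀ w, n + G.dist v w ≤ T) (α : Fin n × Fin m → Fin k) :
    (Measure.infinitePi fun q : Fin k × ℕ => P q.1).map (fun z p => z (slot G v T hn α p)) =
      Measure.pi fun p => P (α p) := by
  have hind : iIndepFun (fun (q : Fin k × ℕ) (z : Fin k × ℕ → ℝ) => z q)
      (Measure.infinitePi fun q : Fin k × ℕ => P q.1) :=
    iIndepFun_infinitePi (X := fun _ => id) fun _ => measurable_id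
  have := (iIndepFun_iff_map_fun_eq_pi_map fun p =>
    (measurable_pi_apply (slot G v T hn α p)).aemeasurable).1
    (hind.precomp (slot_injective hn hT α))
  rw [this]
  congr 1
  funext p
  exact Measure.infinitePi_map_eval _ (slot G v T hn α p)

lemma measurable_stackOf (hn : 1 ≤ n) (L : List (ℕ × Fin m)) (act : ℕ → Fin m → Fin k) :
    Measurable fun x : Fin n × Fin m → ℝ => stackOf L act (extend hn x) := by
  refine measurable_pi_lambda _ fun q => ?_
  unfold stackOf
  cases (L.filter fun p => act p.1 p.2 = q.1)[q.2]? with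
  | none => exact measurable_const
  | some p => exact measurable_pi_apply _

lemma lt_histCount_stackRun_of_leaderState {T u : ℕ} {act : ℕ → Fin m → Fin k}
    {rew : ℕ → Fin m → ℝ} {z : Fin k × ℕ → ℝ} {a : Fin k} (hT : n ≤ T)
    (hrew : ∀ p ∈ arrived G v n, rew p.1 p.2 = stackReward G v T act z p.1 p.2)
    (hact : ∀ t < n, leaderAction G v π act rew (t + 1) = act (t + 1) v)
    (hu : u < histCount (leaderState G v π act rew n).hist a) :
    u < histCount (stackRun π z (m * n)) a := by
  have hS := leaderState_onStack hT hrew hact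
  rw [hS.hist_eq] at hu
  refine hu.trans_le (histCount_mono (stackRun_prefix_of_le π z (hS.le_sum.trans ?_)) a)
  rw [sum_playCount]
  exact length_arrived_le n

/-- The number of updates of the bandit algorithm with a given action is stochastically dominated by
the number of plays of this action in a single-agent run of `m * n` rounds. -/
theorem measure_lt_histCount_le [IsProbabilityMeasure ν] [∀ a, IsProbabilityMeasure (P a)]
    (hn : 1 ≤ n) (hG : G.Connected)
    (hπ : ∀ s : ℕ, Measurable fun h : Fin s → Fin k × ℝ => π (List.ofFn h))
    (hEnv : IsBanditInteraction ν P n A X) (hQ : IsQuack ν G v π n A X) (a : Fin k) (u : ℕ) :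
    ν {ω | u < histCount
        (leaderState G v π (fun s w => A s w ω) (fun s w => X s w ω) n).hist a} ≤
      (Measure.infinitePi fun q : Fin k × ℕ => P q.1)
        {z | u < histCount (stackRun π z (m * n)) a} := by
  classical
  set μ := Measure.infinitePi fun q : Fin k × ℕ => P q.1
  have hk : k ≠ 0 := by rintro rfl; exact a.elim0
  set c : ℝ≥0∞ := (k : ℝ≥0∞)⁻¹ ^ (freePlays n G v).card
  set T := n + ∑ w, G.dist v w
  have hT : ∀ w, n + G.dist v w ≤ T := fun w =>
    Nat.add_le_add_left (Finset.single_le_sum (fun _ _ => Nat.zero_le _) (Finset.mem_univ w)) n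
  have hnT : n ≤ T := Nat.le_add_right _ _
  set bad : Set Ω := {ω | u < histCount
        (leaderState G v π (fun s w => A s w ω) (fun s w => X s w ω) n).hist a} with hbad
  set Bad : Set (Fin k × ℕ → ℝ) := {z | u < histCount (stackRun π z (m * n)) a} with hBad
  have hBadm : MeasurableSet Bad :=
    measurableSet_lt measurable_const (measurable_histCount_stackRun hπ _ _)
  let E : (Fin n × Fin m → Fin k) → Set Ω := fun α =>
    {ω | ∀ p : Fin n × Fin m, A (p.1 + 1) p.2 ω = α p}
  let Cons : (Fin n × Fin m → Fin k) → Set (Fin k × ℕ → ℝ) := fun α =>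
    {z | Consistent G v π n (extend hn α) z}
  have hConsm : ∀ α, MeasurableSet (Cons α) := by
    intro α
    refine (MeasurableSet.const _).inter ?_
    have : {z | ∀ t < n, stackAction G v π (extend hn α) z t = extend hn α (t + 1) v} =
        ⋂ t, ⋂ (_ : t < n), {z | stackAction G v π (extend hn α) z t = extend hn α (t + 1) v} := by
      ext z; simp
    have hm : MeasurableSet
        {z | ∀ t < n, stackAction G v π (extend hn α) z t = extend hn α (t + 1) v} := by
      rw [this]
      exact .iInter fun t => .iInter fun _ =>
        measurable_stackAction hπ G v _ t (measurableSet_singleton _)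
    exact hm
  have hXm : Measurable fun ω (p : Fin n × Fin m) => X (p.1 + 1) p.2 ω :=
    measurable_pi_lambda _ fun p => hEnv.measurable_reward _ (by simp) _
  have hround : ∀ p ∈ arrived G v n, 1 ≤ p.1 ∧ p.1 ≤ n := by
    rintro ⟨s, w⟩ hp
    have := mem_arrived.1 hp
    exact ⟨this.1, by simp only; omega⟩
  have hone : ∀ α, ν (E α ∩ bad) ≤ c * μ (Bad ∩ Cons α) := by
    intro α
    -- The protocol and the bad event as conditions on the reward array alone, phrased through
    -- stacks because measurability is available there.
    let B : Set (Fin n × Fin m → ℝ) :=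
      {x | Consistent G v π n (extend hn α) (stackOf (arrived G v T) (extend hn α) (extend hn x)) ∧
        u < histCount (stackRun π (stackOf (arrived G v T) (extend hn α) (extend hn x))
          (runIndex G v π (extend hn α)
            (stackOf (arrived G v T) (extend hn α) (extend hn x)) n)) a}
    have hBm : MeasurableSet B :=
      ((measurable_stackOf hn (arrived G v T) (extend hn α)) (hConsm α)).inter
        (measurableSet_lt measurable_const ((measurable_histCount_runIndex hπ G v _ n a).comp
          (measurable_stackOf hn (arrived G v T) (extend hn α))))
    have hstack : ∀ x : Fin n × Fin m → ℝ, ∀ p ∈ arrived G v n, extend hn x p.1 p.2 =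
        stackReward G v T (extend hn α)
          (stackOf (arrived G v T) (extend hn α) (extend hn x)) p.1 p.2 :=
      fun x p hp => (stackReward_stackOf ((arrived_prefix_of_le hnT).subset hp)).symm
    have hsub : E α ∩ bad ⊆ (fun ω (p : Fin n × Fin m) => X (p.1 + 1) p.2 ω) ⁻¹' B ∩ E α := by
      rintro ω ⟨hω, hωb⟩
      refine ⟨?_, hω⟩
      set x : Fin n × Fin m → ℝ := fun p => X (p.1 + 1) p.2 ω with hx
      have hA : ∀ s, 1 ≤ s → s ≤ n → ∀ w, A s w ω = extend hn α s w := by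
        intro s h1 h2 w
        rw [extend_eq hn α h1 h2, ← hω]
        simp only [Nat.sub_add_cancel h1]
      have hXx : ∀ s, 1 ≤ s → s ≤ n → ∀ w, X s w ω = extend hn x s w := by
        intro s h1 h2 w
        rw [extend_eq hn x h1 h2, hx]
        simp only [Nat.sub_add_cancel h1]
      have hlead : ∀ t < n, leaderAction G v π (extend hn α) (extend hn x) (t + 1) =
          extend hn α (t + 1) v := by
        intro t ht
        rw [← hA (t + 1) (by omega) (by omega), hQ.leader (t + 1) (by simp; omega)]
        exact leaderAction_congr hG (fun s h1 h2 w => (hA s h1 (by omega) w).symm)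
          fun s h1 h2 w => (hXx s h1 (by omega) w).symm
      have hb : u < histCount (leaderState G v π (extend hn α) (extend hn x) n).hist a := by
        rw [hbad, Set.mem_ofPred_eq, leaderState_congr hA hXx] at hωb
        exact hωb
      refine ⟨⟨fun t h1 h2 w hw hd => ?_, (forall_leaderAction_iff hnT (hstack x)).1 hlead⟩, ?_⟩
      · rw [← hA t h1 h2, ← hA _ (by omega) (by omega)]
        exact hQ.follower t (Finset.mem_Icc.2 ⟨h1, h2⟩) w hw hd ω
      · rwa [← (leaderState_onStack hnT (hstack x) hlead).hist_eq]
    -- `z` and the stacks rebuilt from `x` may differ, but they give the same rewards to all plays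
    -- known by round `n`; the leader's behaviour on these rewards links the two.
    have hsub' : (fun (z : Fin k × ℕ → ℝ) p => z (slot G v T hn α p)) ⁻¹' B ⊆ Bad ∩ Cons α := by
      intro z hz
      set x : Fin n × Fin m → ℝ := fun p => z (slot G v T hn α p) with hx
      obtain ⟨⟨hfol, hact⟩, hcount⟩ : x ∈ B := hz
      have hlead := (forall_leaderAction_iff hnT (hstack x)).2 hact
      rw [← (leaderState_onStack hnT (hstack x) hlead).hist_eq] at hcount
      have hrew : ∀ p ∈ arrived G v n,
          extend hn x p.1 p.2 = stackReward G v T (extend hn α) z p.1 p.2 := fun p hp =>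
        extend_comp_slot hn α z (hround p hp).1 (hround p hp).2 p.2
      exact ⟨lt_histCount_stackRun_of_leaderState hnT hrew hlead hcount, hfol,
        (forall_leaderAction_iff hnT hrew).1 hlead⟩
    have hslotm : Measurable fun (z : Fin k × ℕ → ℝ) p => z (slot G v T hn α p) :=
      measurable_pi_lambda _ fun p => measurable_pi_apply _
    calc ν (E α ∩ bad) ≤ ν ((fun ω (p : Fin n × Fin m) => X (p.1 + 1) p.2 ω) ⁻¹' B ∩ E α) :=
          measure_mono hsub
      _ = (ν.restrict (E α)).map (fun ω (p : Fin n × Fin m) => X (p.1 + 1) p.2 ω) B := by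
          rw [Measure.map_apply hXm hBm, Measure.restrict_apply (hXm hBm)]
      _ ≤ (c • Measure.pi fun p => P (α p)) B := map_restrict_le hn hk hEnv hQ α B
      _ = c * μ ((fun (z : Fin k × ℕ → ℝ) p => z (slot G v T hn α p)) ⁻¹' B) := by
          rw [Measure.smul_apply, smul_eq_mul, ← map_slot_infinitePi hn hT α,
            Measure.map_apply hslotm hBm]
      _ ≤ c * μ (Bad ∩ Cons α) := by gcongr
  have hcover : bad ⊆ ⋃ α, E α ∩ bad := fun ω hω =>
    Set.mem_iUnion.2 ⟨fun p => A (p.1 + 1) p.2 ω, fun p => rfl, hω⟩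
  calc ν bad ≤ ∑ α, ν (E α ∩ bad) := (measure_mono hcover).trans (measure_iUnion_fintype_le _ _)
    _ ≤ ∑ α, c * μ (Bad ∩ Cons α) := Finset.sum_le_sum fun α _ => hone α
    _ = c * ∫⁻ z, ∑ α, (Bad ∩ Cons α).indicator 1 z ∂μ := by
        rw [← Finset.mul_sum, lintegral_finsetSum _ fun α _ =>
          measurable_one.indicator (hBadm.inter (hConsm α))]
        simp_rw [lintegral_indicator_one (hBadm.inter (hConsm _))]
    _ ≤ c * ∫⁻ z, Bad.indicator (fun _ => (k : ℝ≥0∞) ^ (freePlays n G v).card) z ∂μ := by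
        gcongr with z
        by_cases hz : z ∈ Bad
        · have : ∀ α, (Bad ∩ Cons α).indicator (1 : (Fin k × ℕ → ℝ) → ℝ≥0∞) z =
              if z ∈ Cons α then 1 else 0 := fun α => by
            simp [Set.indicator_apply, hz]
          simp only [this, Finset.sum_boole, Set.indicator_of_mem hz]
          have hcard := card_consistent_le (π := π) (v := v) hG hn z
          rw [Set.ncard_eq_toFinset_card'] at hcard
          rw [← Nat.cast_pow, Nat.cast_le]
          refine le_trans (le_of_eq ?_) hcard
          congr 1
          ext α
          simp [Cons]
        · simp [hz]
    _ = μ Bad := by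
        rw [lintegral_indicator_const hBadm, ← mul_assoc, ← mul_pow,
          ENNReal.inv_mul_cancel (by simpa using hk) (by simp), one_pow, one_mul]

end Compare

/-! ### The upper confidence bound algorithm on stacks -/

lemma measureReal_lt_le_of_subgaussian {β : Type*} [MeasurableSpace β] {μ : Measure β}
    [IsProbabilityMeasure μ] {Y : β → ℝ} {c : ℝ≥0} (hY : HasSubgaussianMGF Y c μ) {ε L : ℝ}
    (hε : 0 ≤ ε) (hL : 2 * c * L ≤ ε ^ 2) : μ.real {ω | ε < Y ω} ≤ Real.exp (-L) := by
  rcases eq_or_ne c 0 with rfl | hc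
  -- For `c = 0` the Chernoff exponent would divide by zero; here `Y` vanishes almost surely.
  · have h0 : μ {ω | ε < Y ω} = 0 := by
      have := hY.ae_eq_zero_of_hasSubgaussianMGF_zero
      rw [Filter.EventuallyEq, ae_iff] at this
      refine measure_mono_null (fun ω hω => ?_) this
      exact (hε.trans_lt hω).ne'
    rw [Measure.real, h0]
    exact (Real.exp_pos _).le
  · have hc' : (0 : ℝ) < c := by positivity
    calc μ.real {ω | ε < Y ω} ≤ μ.real {ω | ε ≤ Y ω} :=
          measureReal_mono fun ω hω => (show ε < Y ω from hω).le
      _ ≤ Real.exp (-ε ^ 2 / (2 * c)) := hY.measure_ge_le hε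
      _ ≤ Real.exp (-L) := by
          rw [Real.exp_le_exp, div_le_iff₀ (by positivity)]
          linarith

section UCB

variable {k : ℕ} {P : Fin k → Measure ℝ} {π : Policy k}

lemma hasSubgaussianMGF_sum_stack [∀ a, IsProbabilityMeasure (P a)] {c : ℝ≥0} {a : Fin k}
    (hP : HasSubgaussianMGF (fun x => x - rewardMean P a) c (P a)) (s : ℕ) :
    HasSubgaussianMGF (fun z : Fin k × ℕ → ℝ => ∑ i ∈ Finset.range s, (z (a, i) - rewardMean P a))
      (s * c) (Measure.infinitePi fun q : Fin k × ℕ => P q.1) := by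
  have hind : iIndepFun (fun (i : ℕ) (z : Fin k × ℕ → ℝ) => z (a, i) - rewardMean P a)
      (Measure.infinitePi fun q : Fin k × ℕ => P q.1) :=
    (iIndepFun_infinitePi (P := fun q : Fin k × ℕ => P q.1)
      (X := fun _ x => x - rewardMean P a)
      fun _ => measurable_id.sub_const _).precomp (g := fun i : ℕ => (a, i))
      fun i j h => congrArg Prod.snd h
  have := HasSubgaussianMGF.sum_of_iIndepFun hind (c := fun _ => c) (s := Finset.range s)
    fun i _ => ?_
  · simpa using this
  · refine HasSubgaussianMGF.of_map (X := fun x : ℝ => x - rewardMean P a)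
      (Y := fun z : Fin k × ℕ → ℝ => z (a, i)) (measurable_pi_apply _).aemeasurable ?_
    rwa [Measure.infinitePi_map_eval (fun q : Fin k × ℕ => P q.1) (a, i)]

/-- Consider the selection of `a` after `u` plays. Unless the sample mean of `a` is too high by more
than half the gap, its index is below `μb`, and then so is the index of `b`. The play count of `b`
at that time is random, hence the existential over `s`. -/
lemma exists_deviation_of_lt_histCount {σ δ : ℝ} (hπ : IsUCB σ δ π) {a b : Fin k} {μa μb : ℝ}
    {u N : ℕ} (hu : 1 ≤ u)
    (hconf : √(2 * σ ^ 2 * Real.log (1 / δ) / u) < (μb - μa) / 2) {z : Fin k × ℕ → ℝ}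
    (h : u < histCount (stackRun π z N) a) :
    (∃ s ∈ Finset.Icc 1 N, s * √(2 * σ ^ 2 * Real.log (1 / δ) / s) <
      -∑ i ∈ Finset.range s, (z (b, i) - μb)) ∨
    u * ((μb - μa) / 2) < ∑ i ∈ Finset.range u, (z (a, i) - μa) := by
  obtain ⟨j, hj, hcount, hsel⟩ := exists_selected_of_lt_histCount π z h
  have hmax := hπ.isMax (stackRun π z j) b
  rw [hsel, ucbIndex, ucbIndex, hcount, if_neg (by omega : u ≠ 0), histMean_stackRun,
    histMean_stackRun, hcount] at hmax
  split_ifs at hmax with hb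
  -- The index of `a` is finite because `u ≥ 1`, so `b` has been tried.
  · exact absurd (top_le_iff.1 hmax) (EReal.coe_ne_top _)
  rw [EReal.coe_le_coe_iff] at hmax
  set s := histCount (stackRun π z j) b
  have hs1 : 1 ≤ s := Nat.one_le_iff_ne_zero.2 hb
  have hsN : s ≤ N := by
    have := histCount_le_length (stackRun π z j) b
    rw [length_stackRun] at this
    omega
  by_contra! hcon
  obtain ⟨h1, h2⟩ := hcon
  have h1 := h1 s (Finset.mem_Icc.2 ⟨hs1, hsN⟩)
  have hs0 : (0 : ℝ) < s := by exact_mod_cast hs1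
  have hu0 : (0 : ℝ) < u := by exact_mod_cast hu
  simp only [Finset.sum_sub_distrib, Finset.sum_const, Finset.card_range, nsmul_eq_mul] at h1 h2
  have h1' : μb - √(2 * σ ^ 2 * Real.log (1 / δ) / s) ≤
      (∑ i ∈ Finset.range s, z (b, i)) / s := by
    rw [le_div_iff₀ hs0]; linarith
  have h2' : (∑ i ∈ Finset.range u, z (a, i)) / u ≤ μa + (μb - μa) / 2 := by
    rw [div_le_iff₀ hu0]; linarith
  linarith

/-- With confidence parameter `1 / N ^ 2`, more than `u` plays of an action in `N` rounds are
unlikely. -/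
lemma measureReal_lt_histCount_stackRun_le [∀ a, IsProbabilityMeasure (P a)] {σ : ℝ≥0}
    (hP : ∀ a, HasSubgaussianMGF (fun x => x - rewardMean P a) (σ ^ 2) (P a)) {N : ℕ}
    (hN : 1 ≤ N) (hπ : IsUCB (σ : ℝ) (1 / (N : ℝ) ^ 2) π) {a b : Fin k}
    (hab : rewardMean P a < rewardMean P b) {u : ℕ}
    (hu : 16 * (σ : ℝ) ^ 2 * Real.log N / (rewardMean P b - rewardMean P a) ^ 2 < u) :
    (Measure.infinitePi fun q : Fin k × ℕ => P q.1).real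
      {z | u < histCount (stackRun π z N) a} ≤ 1 / N + 1 / N := by
  set μ := Measure.infinitePi fun q : Fin k × ℕ => P q.1
  set Δ := rewardMean P b - rewardMean P a with hΔ
  have hΔ0 : 0 < Δ := sub_pos.2 hab
  have hN0 : (0 : ℝ) < N := by exact_mod_cast hN
  have hN1 : (1 : ℝ) ≤ N := by exact_mod_cast hN
  have hlog : 0 ≤ Real.log N := Real.log_nonneg hN1
  have hu0 : (0 : ℝ) < u := lt_of_le_of_lt (by positivity) hu
  have hlogδ : Real.log (1 / (1 / (N : ℝ) ^ 2)) = 2 * Real.log N := by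
    rw [one_div_one_div, Real.log_pow]; norm_num
  have hexp : Real.exp (-(2 * Real.log N)) = 1 / (N : ℝ) ^ 2 := by
    rw [← hlogδ, Real.exp_neg, Real.exp_log (by positivity)]; simp
  have hu' : 16 * (σ : ℝ) ^ 2 * Real.log N < u * Δ ^ 2 := by
    rwa [div_lt_iff₀ (by positivity)] at hu
  have hconf : √(2 * (σ : ℝ) ^ 2 * Real.log (1 / (1 / (N : ℝ) ^ 2)) / u) < Δ / 2 := by
    rw [Real.sqrt_lt' (by positivity), hlogδ, div_lt_iff₀ hu0]
    linarith
  have hopt : ∀ s ∈ Finset.Icc 1 N, μ.real {z |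
      s * √(2 * (σ : ℝ) ^ 2 * Real.log (1 / (1 / (N : ℝ) ^ 2)) / s) <
        -∑ i ∈ Finset.range s, (z (b, i) - rewardMean P b)} ≤ 1 / (N : ℝ) ^ 2 := by
    intro s hs
    have hs0 : (0 : ℝ) < s := by exact_mod_cast (Finset.mem_Icc.1 hs).1
    refine le_trans (measureReal_lt_le_of_subgaussian (L := 2 * Real.log N)
      (hasSubgaussianMGF_sum_stack (hP b) s).neg (by positivity) ?_) hexp.le
    -- The confidence width is calibrated to give equality here.
    rw [mul_pow, Real.sq_sqrt (by rw [hlogδ]; positivity), hlogδ]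
    push_cast
    apply le_of_eq
    field_simp
  have hsub : μ.real {z | u * (Δ / 2) < ∑ i ∈ Finset.range u, (z (a, i) - rewardMean P a)} ≤
      1 / (N : ℝ) ^ 2 := by
    rw [← hexp]
    refine measureReal_lt_le_of_subgaussian (hasSubgaussianMGF_sum_stack (hP a) u)
      (by positivity) ?_
    push_cast
    nlinarith [mul_lt_mul_of_pos_left hu' hu0]
  have hle : {z | u < histCount (stackRun π z N) a} ⊆
      (⋃ s ∈ Finset.Icc 1 N, {z |
        s * √(2 * (σ : ℝ) ^ 2 * Real.log (1 / (1 / (N : ℝ) ^ 2)) / s) <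
          -∑ i ∈ Finset.range s, (z (b, i) - rewardMean P b)}) ∪
      {z | u * (Δ / 2) < ∑ i ∈ Finset.range u, (z (a, i) - rewardMean P a)} := by
    intro z hz
    rcases exists_deviation_of_lt_histCount hπ (b := b) (by exact_mod_cast hu0) hconf hz with
      ⟨s, hs, h⟩ | h
    · exact Or.inl (Set.mem_biUnion hs h)
    · exact Or.inr h
  calc _ ≤ _ := measureReal_mono hle
    _ ≤ _ := measureReal_union_le _ _
    _ ≤ ∑ s ∈ Finset.Icc 1 N, 1 / (N : ℝ) ^ 2 + 1 / (N : ℝ) ^ 2 :=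
        add_le_add ((measureReal_biUnion_finset_le _ _).trans (Finset.sum_le_sum hopt)) hsub
    _ = 1 / N + 1 / (N : ℝ) ^ 2 := by
        simp
        field_simp
    _ ≤ 1 / N + 1 / N := by
        gcongr
        exact le_self_pow₀ hN1 two_ne_zero

end UCB

/-! ### The regret bound -/

lemma gap_nonneg {k : ℕ} (P : Fin k → Measure ℝ) (a : Fin k) : 0 ≤ gap P a :=
  sub_nonneg.2 (le_ciSup (Set.finite_range _).bddAbove a)

lemma integral_plays_le {m k n : ℕ} (hn : 1 ≤ n) {G : SimpleGraph (Fin m)} (hG : G.Connected)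
    {v : Fin m} {P : Fin k → Measure ℝ} [∀ a, IsProbabilityMeasure (P a)] {σ : ℝ≥0}
    (hP : ∀ a, HasSubgaussianMGF (fun x => x - rewardMean P a) (σ ^ 2) (P a))
    {π : Policy k} (hπ : IsUCB (σ : ℝ) (1 / ((m : ℝ) * n) ^ 2) π)
    {Ω : Type*} [MeasurableSpace Ω] {ν : Measure Ω} [IsProbabilityMeasure ν]
    {A : ℕ → Fin m → Ω → Fin k} {X : ℕ → Fin m → Ω → ℝ}
    (hEnv : IsBanditInteraction ν P n A X) (hQ : IsQuack ν G v π n A X) {a : Fin k}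
    (ha : 0 < gap P a) :
    ∫ ω, (∑ w, (plays A a w n ω : ℝ)) ∂ν ≤
      16 * (σ : ℝ) ^ 2 * Real.log (m * n) / gap P a ^ 2 + 3 + 2 * ∑ w, (G.dist v w : ℝ) := by
  have : Nonempty (Fin k) := ⟨a⟩
  obtain ⟨b, hb⟩ := exists_eq_ciSup_of_finite (f := rewardMean P)
  have hgap : gap P a = rewardMean P b - rewardMean P a := by rw [gap, hb]
  have hm : 1 ≤ m := v.pos
  have hN : 1 ≤ m * n := Nat.one_le_iff_ne_zero.2 (by positivity)
  have hN1 : (1 : ℝ) ≤ m * n := by exact_mod_cast hN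
  have hN0 : (0 : ℝ) < m * n := by linarith
  set x := 16 * (σ : ℝ) ^ 2 * Real.log (m * n) / gap P a ^ 2 with hx
  have hx0 : 0 ≤ x := by
    have := Real.log_nonneg hN1
    positivity
  -- The tail bound needs `x < u` strictly, and `u ≤ x + 1` limits the cost.
  set u := ⌊x⌋₊ + 1 with hu
  have hxu : x < u := by simpa [hu] using Nat.lt_floor_add_one x
  have hux : (u : ℝ) ≤ x + 1 := by
    have := Nat.floor_le hx0
    simp [hu, this]
  set h : Ω → List (Fin k × ℝ) := fun ω =>
    (leaderState G v π (fun s w => A s w ω) (fun s w => X s w ω) n).hist with hh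
  set bad : Set Ω := {ω | u < histCount (h ω) a} with hbad
  have hbadle : ν.real bad ≤ 1 / (m * n) + 1 / (m * n) := by
    have h1 := measure_lt_histCount_le hn hG hπ.measurable hEnv hQ a u
    have h2 := measureReal_lt_histCount_stackRun_le hP hN (by push_cast; exact hπ)
      (sub_pos.1 (hgap ▸ ha)) (u := u) (by rw [← hgap]; push_cast; exact hxu)
    push_cast at h2
    exact (ENNReal.toReal_mono (measure_ne_top _ _) h1).trans h2
  have hact : ∀ ω, ∀ t < n, leaderAction G v π (fun s w => A s w ω) (fun s w => X s w ω) (t + 1) =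
      A (t + 1) v ω := fun ω t ht => (hQ.leader (t + 1) (by simp; omega) ω).symm
  have hlen : ∀ ω, histCount (h ω) a ≤ m * n := by
    intro ω
    have hS := leaderState_onStack (T := n) (z := stackOf (arrived G v n) _ _) le_rfl
      (fun p hp => (stackReward_stackOf hp).symm) (hact ω)
    refine (histCount_le_length _ _).trans ?_
    simp only [hh]
    rw [hS.hist_eq, length_stackRun]
    exact hS.le_sum.trans ((sum_playCount _ _).trans_le (length_arrived_le n))
  -- The measurable hull has the same measure as `bad` and spares proving that `bad` is measurable.
  have hpt : ∀ ω, (∑ w, (plays A a w n ω : ℝ)) ≤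
      (u + 2 * ∑ w, (G.dist v w : ℝ)) +
        (toMeasurable ν bad).indicator (fun _ => (m * n : ℝ)) ω := by
    intro ω
    have h1 : (∑ w, (plays A a w n ω : ℝ)) ≤
        histCount (h ω) a + 2 * ∑ w, (G.dist v w : ℝ) := by
      exact_mod_cast sum_card_plays_le (hact ω)
        (fun t h1 h2 w hw hd => hQ.follower t (Finset.mem_Icc.2 ⟨h1, h2⟩) w hw hd ω) a
    by_cases hω : ω ∈ bad
    · rw [Set.indicator_of_mem (subset_toMeasurable _ _ hω)]
      have : (histCount (h ω) a : ℝ) ≤ m * n := by exact_mod_cast hlen ω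
      have : (0 : ℝ) ≤ u := by positivity
      linarith
    · have h2 : (histCount (h ω) a : ℝ) ≤ u := by exact_mod_cast not_lt.1 hω
      have h3 : (0 : ℝ) ≤ (toMeasurable ν bad).indicator (fun _ => (m * n : ℝ)) ω :=
        Set.indicator_nonneg (fun _ _ => hN0.le) _
      linarith
  have hint : Integrable ((toMeasurable ν bad).indicator fun _ => (m * n : ℝ)) ν :=
    (integrable_const _).indicator (measurableSet_toMeasurable _ _)
  calc ∫ ω, (∑ w, (plays A a w n ω : ℝ)) ∂ν
      ≤ ∫ ω, ((u + 2 * ∑ w, (G.dist v w : ℝ)) +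
        (toMeasurable ν bad).indicator (fun _ => (m * n : ℝ)) ω) ∂ν :=
        integral_mono_of_nonneg (.of_forall fun ω => Finset.sum_nonneg fun w _ => Nat.cast_nonneg _)
          ((integrable_const _).add hint) (.of_forall hpt)
    _ = (u + 2 * ∑ w, (G.dist v w : ℝ)) + ν.real bad * (m * n) := by
        rw [integral_add (integrable_const _) hint,
          integral_indicator_const _ (measurableSet_toMeasurable _ _), Measure.real,
          measure_toMeasurable]
        simp [Measure.real]
    _ ≤ (x + 1 + 2 * ∑ w, (G.dist v w : ℝ)) + (1 / (m * n) + 1 / (m * n)) * (m * n) := by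
        gcongr
    _ = x + 3 + 2 * ∑ w, (G.dist v w : ℝ) := by
        have : (1 / (m * n : ℝ) + 1 / (m * n)) * (m * n) = 2 := by field_simp; norm_num
        rw [this]; ring

end Quack

theorem mainTheorem2 {m k n : ℕ} (hn : 1 ≤ n)
    (G : SimpleGraph (Fin m)) (hG : G.Connected) (v : Fin m)
    (P : Fin k → Measure ℝ) [∀ a, IsProbabilityMeasure (P a)] (σ : ℝ≥0)
    (hP : ∀ a, HasSubgaussianMGF (fun x => x - Quack.rewardMean P a) (σ ^ 2) (P a))
    (π : Quack.Policy k) (hπ : Quack.IsUCB (σ : ℝ) (1 / ((m : ℝ) * n) ^ 2) π)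
    {Ω : Type*} [MeasurableSpace Ω] (ν : Measure Ω) [IsProbabilityMeasure ν]
    (A : ℕ → Fin m → Ω → Fin k) (X : ℕ → Fin m → Ω → ℝ)
    (hEnv : Quack.IsBanditInteraction ν P n A X) (hQ : Quack.IsQuack ν G v π n A X) :
    Quack.groupRegret ν P A n ≤
      (∑ a with 0 < Quack.gap P a, 16 * (σ : ℝ) ^ 2 * Real.log (m * n) / Quack.gap P a) +
        (3 + 3 * ∑ w, (G.dist v w : ℝ)) * ∑ a with 0 < Quack.gap P a, Quack.gap P a := by
  have hpos : Quack.groupRegret ν P A n = ∑ a with 0 < Quack.gap P a,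
      Quack.gap P a * ∫ ω, (∑ w, (Quack.plays A a w n ω : ℝ)) ∂ν := by
    rw [Quack.groupRegret, Finset.sum_filter_of_ne]
    intro a _ ha
    exact lt_of_le_of_ne (Quack.gap_nonneg P a) (Ne.symm (left_ne_zero_of_mul ha))
  rw [hpos, Finset.mul_sum, ← Finset.sum_add_distrib]
  refine Finset.sum_le_sum fun a ha => ?_
  have ha := (Finset.mem_filter.1 ha).2
  have hD : (0 : ℝ) ≤ ∑ w, (G.dist v w : ℝ) := by positivity
  calc _ ≤ Quack.gap P a * (16 * (σ : ℝ) ^ 2 * Real.log (m * n) / Quack.gap P a ^ 2 + 3 +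
        2 * ∑ w, (G.dist v w : ℝ)) := by
        gcongr
        exact Quack.integral_plays_le hn hG hP hπ hEnv hQ ha
    _ = 16 * (σ : ℝ) ^ 2 * Real.log (m * n) / Quack.gap P a +
        (3 + 2 * ∑ w, (G.dist v w : ℝ)) * Quack.gap P a := by
        field_simp
        ring
    -- The proof gives `2∑ d_vw`; the stated `3∑ d_vw` is weaker.
    _ ≤ _ := by
        gcongr
        norm_num
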